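/- **Theorem (Hardy baseline on strongly geodesically convex balls).** Let $-f(r)\,dt^2+f(r)^{-1}dr^2+r^2d\Omega^2$, $r>r_+>0$, be a static, spherically symmetric, asymptotically flat black-hole exterior: $f\in C^2((r_+,\infty))$, $f>0$ on $(r_+,\infty)$, $f(r_+)=0$ (continuously), and $f-1=O(r^{-1})$, $f'=O(r^{-2})$, $f''=O(r^{-3})$ as $r\to\infty$. Let $\Sigma_\Theta=\{t+\Theta(r)=\mathrm{const}\}$, $r>r_+$, with $\Theta$ smooth, be an admissible slice, i.e. it is spacelike and horizon-regular: the radial coefficient $a(r)=1/f-f\,\Theta'^2$ of its induced metric $h_\Theta=a(r)\,dr^2+r^2d\Omega^2$ is positive and has a positive $C^2$ extension to $r>r_{\rm in}$ for some $0\le r_{\rm in}<r_+$. Geodesic balls are taken in the slice so extended across the horizon. For an open geodesic ball $B$ let $$\lambda_1(B)=\inf_{0\ne u\in H^1_0(B)}\frac{\int_B|\nabla u|^2_{h_\Theta}\,dV_{h_\Theta}}{\int_B u^2\,dV_{h_\Theta}}$$ be the first Dirichlet eigenvalue of $-\Delta_{h_\Theta}$, and put $c(\Theta)=\inf_{x\in\Sigma_\Theta}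 r_g\sqrt{\lambda_1(B_{r_g}(x))}$. For $\psi\in H^1_0(B;\mathbb C)$ with $\|\psi\|_{L^2}=1$ and an $h_\Theta$-orthonormal frame $(e_a)$ on $B$, let $P_a=-i\hbar\nabla_{e_a}$ and $$\sigma_p^2=\sum_{a=1}^3\Big(\|P_a\psi\|^2-\big(\operatorname{Re}\langle\psi,P_a\psi\rangle\big)^2\Big).$$ Fix $r_g>0$ and assume that for every $x\in\Sigma_\Theta$ the ball $B_{r_g}(x)$ is well defined, $r_g<\mathrm{inj}(x)$ (the exponential map at $x$ is defined and a diffeomorphism onto its image on a ball of radius larger than $r_g$), and strongly geodesically convex in the sense that the inward normal exponential map is a diffeomorphism from $\partial B_{r_g}(x)\times(0,r_g)$ onto $B_{r_g}(x)\setminus\{x\}$. Then, for every $x\in\Sigma_\Theta$, $$\lambda_1(B_{r_g}(x))\ \ge\ \frac1{4r_g^2},$$ and every Dirichlet eigenvalue of $-\Delta_{h_\Theta}$ on $B_{r_g}(x)$ is at least $1/(4r_g^2)$. Hence $c(\Theta)\ge\tfrac12$, and $\sigma_p\,r_g\ge\hbar/2$ for every $x\in\Sigma_\Theta$, every $\hbar>0$,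 every such frame on $B_{r_g}(x)$ and every normalized $\psi\in H^1_0(B_{r_g}(x);\mathbb C)$. -/

import Mathlib

open Set Filter Topology MeasureTheory Asymptotics
open scoped ContDiff

noncomputable section

/-- Three-dimensional coordinate space. -/
abbrev E3 : Type := EuclideanSpace ℝ (Fin 3)

/-! ## Riemannian geometry on an open set `U` of `E3`

A metric is given by its coefficient matrix `g x = (g_{ij}(x))` in the coordinates of `E3`. -/

namespace Riem

/-- The partial derivative `∂_i φ (x)`. -/
def pderiv {F : Type*} [NormedAddCommGroup F] [NormedSpace ℝ F]
    (i : Fin 3) (φ : E3 → F) (x : E3) : F :=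
  fderiv ℝ φ x (EuclideanSpace.single i 1)

/-- The scalar product `g_x(v, w)` of two tangent vectors at `x`. -/
def metricInner (g : E3 → Matrix (Fin 3) (Fin 3) ℝ) (x v w : E3) : ℝ :=
  ∑ i, ∑ j, g x i j * v i * w j

/-- The length `|v|_g` of a tangent vector at `x`. -/
def metricNorm (g : E3 → Matrix (Fin 3) (Fin 3) ℝ) (x v : E3) : ℝ :=
  Real.sqrt (metricInner g x v v)

/-- The Christoffel symbol `Γ^k_{ij}` of the Levi-Civita connection of `g`. -/
def christoffel (g : E3 → Matrix (Fin 3) (Fin 3) ℝ) (x : E3) (k i j : Fin 3) : ℝ :=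
  (1 / 2) * ∑ l, (g x)⁻¹ k l *
    (pderiv i (fun y => g y j l) x + pderiv j (fun y => g y i l) x - pderiv l (fun y => g y i j) x)

/-- The right-hand side of the geodesic equation `γ''^k = - Γ^k_{ij} γ'^i γ'^j`. -/
def geodesicAccel (g : E3 → Matrix (Fin 3) (Fin 3) ℝ) (x v : E3) : E3 :=
  WithLp.toLp 2 (fun k => - ∑ i, ∑ j, christoffel g x k i j * v i * v j)

/-- `y = exp_x(v)`: the geodesic of `(U, g)` that starts at `x` with velocity `v` exists on `[0,1]`,
stays in `U`, and is at `y` at time `1`. -/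
def IsExp (U : Set E3) (g : E3 → Matrix (Fin 3) (Fin 3) ℝ) (x v y : E3) : Prop :=
  ∃ γ w : ℝ → E3, γ 0 = x ∧ w 0 = v ∧ γ 1 = y ∧
    ∀ t ∈ Icc (0 : ℝ) 1, γ t ∈ U ∧
      HasDerivWithinAt γ (w t) (Icc 0 1) t ∧
      HasDerivWithinAt w (geodesicAccel g (γ t) (w t)) (Icc 0 1) t

/-- The Riemannian length of a curve parametrized by `[0,1]`. -/
def curveLength (g : E3 → Matrix (Fin 3) (Fin 3) ℝ) (γ : ℝ → E3) : ℝ :=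
  ∫ t in (0 : ℝ)..1, metricNorm g (γ t) (derivWithin γ (Icc 0 1) t)

/-- The open geodesic ball: the points of `U` at Riemannian distance less than `r` from `x`, the
distance being the infimum of the lengths of the `C¹` curves in `U`. -/
def geodBall (U : Set E3) (g : E3 → Matrix (Fin 3) (Fin 3) ℝ) (x : E3) (r : ℝ) : Set E3 :=
  {y | ∃ γ : ℝ → E3, ContDiffOn ℝ 1 γ (Icc 0 1) ∧ MapsTo γ (Icc 0 1) U ∧ γ 0 = x ∧ γ 1 = y ∧
    curveLength g γ < r}

/-- The ball of radius `r` around `x` is well defined, `r < inj(x)`: on a ball of `T_x U` of some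
radius `ρ > r` the exponential map at `x` is defined and is a diffeomorphism onto its image. -/
def BallWellDefined (U : Set E3) (g : E3 → Matrix (Fin 3) (Fin 3) ℝ) (x : E3) (r : ℝ) : Prop :=
  ∃ ρ > r, ∃ E : E3 → E3,
    (∀ v, metricNorm g x v < ρ → IsExp U g x v (E v)) ∧
    InjOn E {v | metricNorm g x v < ρ} ∧
    ContDiffOn ℝ 1 E {v | metricNorm g x v < ρ} ∧
    ∀ v, metricNorm g x v < ρ → Function.Bijective (fderiv ℝ E v)

/-- The boundary `∂B` of a set `B` in the Riemannian manifold `U`. -/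
def bdry (U B : Set E3) : Set E3 := frontier B ∩ U

/-- `ν` is the inward unit normal of `∂B` at `z`: it has length one, is orthogonal to the
velocities at `z` of all curves in `∂B` through `z`, and points into `B`. -/
def IsInwardUnitNormal (U : Set E3) (g : E3 → Matrix (Fin 3) (Fin 3) ℝ) (B : Set E3)
    (z ν : E3) : Prop :=
  metricNorm g z ν = 1 ∧
  (∀ (c : ℝ → E3) (w : E3), c 0 = z → (∀ t, c t ∈ bdry U B) → HasDerivAt c w 0 →
    metricInner g z ν w = 0) ∧
  ∀ᶠ t in 𝓝[>] (0 : ℝ), z + t • ν ∈ B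

/-- `C¹` maps on an arbitrary subset `X` of a normed space: near each point of `X` the map is the
restriction to `X` of a `C¹` map of the ambient space. -/
def IsC1On {V W : Type*} [NormedAddCommGroup V] [NormedSpace ℝ V] [NormedAddCommGroup W]
    [NormedSpace ℝ W] (F : V → W) (X : Set V) : Prop :=
  ∀ p ∈ X, ∃ F' : V → W, ContDiffAt ℝ 1 F' p ∧ F' =ᶠ[𝓝[X] p] F

/-- `F` restricts to a diffeomorphism of the subset `X` onto the subset `Y`. -/
def IsDiffeoOn {V W : Type*} [NormedAddCommGroup V] [NormedSpace ℝ V] [NormedAddCommGroup W]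
    [NormedSpace ℝ W] (F : V → W) (X : Set V) (Y : Set W) : Prop :=
  IsC1On F X ∧ ∃ I : W → V, IsC1On I Y ∧ MapsTo F X Y ∧ MapsTo I Y X ∧ InvOn I F X Y

/-- Strong geodesic convexity of the ball `B` of radius `r` around `x`: the inward normal
exponential map `(z, t) ↦ exp_z (t ν(z))` is a diffeomorphism of `∂B × (0, r)` onto `B` (without
the center `x`, which all the normal geodesics reach at time `r`). -/
def StronglyConvexBall (U : Set E3) (g : E3 → Matrix (Fin 3) (Fin 3) ℝ) (x : E3) (r : ℝ) : Prop :=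
  ∃ N : E3 × ℝ → E3,
    (∀ z ∈ bdry U (geodBall U g x r), ∃ ν, IsInwardUnitNormal U g (geodBall U g x r) z ν ∧
      ∀ t ∈ Ioo 0 r, IsExp U g z (t • ν) (N (z, t))) ∧
    IsDiffeoOn N (bdry U (geodBall U g x r) ×ˢ Ioo 0 r) (geodBall U g x r \ {x})

/-! ## The Dirichlet problem -/

/-- The Riemannian volume `dV_g = √(det g) dx` on the set `B`. -/
def vol (g : E3 → Matrix (Fin 3) (Fin 3) ℝ) (B : Set E3) : Measure E3 :=
  (volume.restrict B).withDensity (fun x => ENNReal.ofReal (Real.sqrt (g x).det))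

/-- The squared length `g^{ij} \bar ξ_i ξ_j` at `x` of a real or complex covector. For
`ξ = dψ` this is `|∇ψ|_g²`. -/
def coNormSq {𝕜 : Type*} [RCLike 𝕜] (g : E3 → Matrix (Fin 3) (Fin 3) ℝ) (x : E3)
    (ξ : Fin 3 → 𝕜) : ℝ :=
  ∑ i, ∑ j, (g x)⁻¹ i j * RCLike.re (star (ξ i) * ξ j)

/-- The scalar product `g^{ij} ξ_i η_j` at `x` of two real covectors. -/
def coInner (g : E3 → Matrix (Fin 3) (Fin 3) ℝ) (x : E3) (ξ η : Fin 3 → ℝ) : ℝ :=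
  ∑ i, ∑ j, (g x)⁻¹ i j * ξ i * η j

/-- `φ ∈ C_c^∞(B)`. -/
def IsTest {𝕜 : Type*} [RCLike 𝕜] (B : Set E3) (φ : E3 → 𝕜) : Prop :=
  ContDiff ℝ ∞ φ ∧ HasCompactSupport φ ∧ tsupport φ ⊆ B

/-- The differential `dφ = (∂_i φ)_i`. -/
def differential {𝕜 : Type*} [RCLike 𝕜] (φ : E3 → 𝕜) (x : E3) : Fin 3 → 𝕜 :=
  fun i => pderiv i φ x

/-- `u ∈ H_0^1(B)` with weak differential `G`: the pair `(u, G)` is the limit, in the `H¹` norm of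
`g`, of pairs `(φ_n, dφ_n)` with `φ_n ∈ C_c^∞(B)`. -/
def MemH10 {𝕜 : Type*} [RCLike 𝕜] (g : E3 → Matrix (Fin 3) (Fin 3) ℝ) (B : Set E3)
    (u : E3 → 𝕜) (G : E3 → Fin 3 → 𝕜) : Prop :=
  MemLp u 2 (vol g B) ∧ AEStronglyMeasurable G (vol g B) ∧
  ∃ φ : ℕ → E3 → 𝕜, (∀ n, IsTest B (φ n)) ∧
    Tendsto (fun n => ∫⁻ x, ENNReal.ofReal (‖φ n x - u x‖ ^ 2) ∂(vol g B)) atTop (𝓝 0) ∧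
    Tendsto (fun n => ∫⁻ x, ENNReal.ofReal (coNormSq g x (differential (φ n) x - G x)) ∂(vol g B))
      atTop (𝓝 0)

/-- The first Dirichlet eigenvalue of `-Δ_g` on `B`: the infimum of the Rayleigh quotients
`∫ |∇u|² / ∫ u²` over the nonzero `u ∈ H_0^1(B)`. -/
def lambda1 (g : E3 → Matrix (Fin 3) (Fin 3) ℝ) (B : Set E3) : ℝ :=
  sInf {R | ∃ (u : E3 → ℝ) (G : E3 → Fin 3 → ℝ), MemH10 g B u G ∧
    (∫ x, u x ^ 2 ∂(vol g B)) ≠ 0 ∧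
    R = (∫ x, coNormSq g x (G x) ∂(vol g B)) / (∫ x, u x ^ 2 ∂(vol g B))}

/-- `μ` is a Dirichlet eigenvalue of `-Δ_g` on `B`: there is a nonzero `u ∈ H_0^1(B)` with
`-Δ_g u = μ u` weakly. -/
def IsDirichletEigenvalue (g : E3 → Matrix (Fin 3) (Fin 3) ℝ) (B : Set E3) (μ : ℝ) : Prop :=
  ∃ (u : E3 → ℝ) (G : E3 → Fin 3 → ℝ), MemH10 g B u G ∧
    (∫ x, u x ^ 2 ∂(vol g B)) ≠ 0 ∧
    ∀ φ : E3 → ℝ, IsTest B φ →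
      (∫ x, coInner g x (G x) (differential φ x) ∂(vol g B)) = μ * ∫ x, u x * φ x ∂(vol g B)

/-! ## Momentum uncertainty -/

/-- `e` is a (continuous) `g`-orthonormal frame on `B`. -/
def IsOrthonormalFrame (g : E3 → Matrix (Fin 3) (Fin 3) ℝ) (B : Set E3)
    (e : Fin 3 → E3 → E3) : Prop :=
  (∀ a, ContinuousOn (e a) B) ∧
  ∀ x ∈ B, ∀ a b, metricInner g x (e a x) (e b x) = if a = b then 1 else 0

/-- `P ψ = -iħ ∇_e ψ` for a vector field `e` and a state `ψ` with weak differential `G`. -/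
def momentum (hbar : ℝ) (e : E3 → E3) (G : E3 → Fin 3 → ℂ) (x : E3) : ℂ :=
  -Complex.I * (hbar : ℂ) * ∑ i, (e x i : ℂ) * G x i

/-- The momentum variance `∑_a (⟨P_a ψ, P_a ψ⟩ - ⟨p_a⟩²)` of a state `ψ` with weak differential `G`,
where `⟨p_a⟩ = Re ⟨ψ, P_a ψ⟩` (`= ħ ∫ |ψ|² ∇_{e_a} φ` for `ψ = |ψ| exp(i φ)`). -/
def momentumVar (g : E3 → Matrix (Fin 3) (Fin 3) ℝ) (B : Set E3) (hbar : ℝ)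
    (e : Fin 3 → E3 → E3) (ψ : E3 → ℂ) (G : E3 → Fin 3 → ℂ) : ℝ :=
  ∑ a, ((∫ x, ‖momentum hbar (e a) G x‖ ^ 2 ∂(vol g B))
    - (∫ x, star (ψ x) * momentum hbar (e a) G x ∂(vol g B)).re ^ 2)

/-- The momentum uncertainty `σ_p`. -/
def sigmaP (g : E3 → Matrix (Fin 3) (Fin 3) ℝ) (B : Set E3) (hbar : ℝ)
    (e : Fin 3 → E3 → E3) (ψ : E3 → ℂ) (G : E3 → Fin 3 → ℂ) : ℝ :=
  Real.sqrt (momentumVar g B hbar e ψ G)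

end Riem

/-! ## Static black-hole exteriors and their slices -/

/-- A static, spherically symmetric, asymptotically flat black-hole exterior
`-f dt² + f⁻¹ dr² + r² dΩ²`, `r > rPlus`. -/
structure BlackHole where
  f : ℝ → ℝ
  rPlus : ℝ
  rPlus_pos : 0 < rPlus
  f_contDiffOn : ContDiffOn ℝ 2 f (Ioi rPlus)
  f_pos : ∀ r, rPlus < r → 0 < f r
  f_horizon : f rPlus = 0
  f_continuous_horizon : ContinuousWithinAt f (Ici rPlus) rPlus
  falloff0 : (fun r => f r - 1) =O[atTop] (fun r => r ^ (-1 : ℤ))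
  falloff1 : deriv f =O[atTop] (fun r => r ^ (-2 : ℤ))
  falloff2 : deriv (deriv f) =O[atTop] (fun r => r ^ (-3 : ℤ))

/-- An admissible slice `t + Θ(r) = const`: it is spacelike, i.e. the radial coefficient
`1/f - f Θ'²` of the induced metric is positive, and horizon-regular, i.e. that coefficient has a
positive `C²` extension `radial` across the horizon, to the radii `r > rIn` for some
`rIn < rPlus`. -/
structure AdmissibleSlice (S : BlackHole) where
  Θ : ℝ → ℝ
  Θ_smooth : ContDiffOn ℝ ∞ Θ (Ioi S.rPlus)
  rIn : ℝ
  rIn_nonneg : 0 ≤ rIn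
  rIn_lt : rIn < S.rPlus
  radial : ℝ → ℝ
  radial_contDiffOn : ContDiffOn ℝ 2 radial (Ioi rIn)
  radial_pos : ∀ r, rIn < r → 0 < radial r
  radial_eq : ∀ r, S.rPlus < r → radial r = 1 / S.f r - S.f r * (deriv Θ r) ^ 2

namespace AdmissibleSlice

variable {S : BlackHole} (T : AdmissibleSlice S)

/-- The slice `Σ_Θ` of the exterior, in the Cartesian coordinates with `r = ‖x‖`. -/
def slice (_T : AdmissibleSlice S) : Set E3 := {x | S.rPlus < ‖x‖}

/-- The slice together with its extension across the horizon, which contains the balls. -/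
def extSlice : Set E3 := {x | T.rIn < ‖x‖}

/-- The induced metric `h_Θ = radial(r) dr² + r² dΩ²`, in Cartesian coordinates. -/
def metric (x : E3) : Matrix (Fin 3) (Fin 3) ℝ :=
  fun i j => (if i = j then 1 else 0) + (T.radial ‖x‖ - 1) * (x i * x j) / ‖x‖ ^ 2

/-- The geodesic ball `B_{r_g}(x)` of `h_Θ`. -/
def ball (x : E3) (rg : ℝ) : Set E3 := Riem.geodBall T.extSlice T.metric x rg

/-- `J_Θ(x) = r_g √(λ₁(B_{r_g}(x); h_Θ))`. -/
def J (rg : ℝ) (x : E3) : ℝ := rg * Real.sqrt (Riem.lambda1 T.metric (T.ball x rg))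

/-- `c(Θ) = inf_{x ∈ Σ_Θ} J_Θ(x)`. -/
def c (rg : ℝ) : ℝ := ⨅ x : T.slice, T.J rg x

end AdmissibleSlice

end

/-!
The ball of radius `R` around `x₀` lies in the shell `|P(‖x‖) - P(‖x₀‖)| < R`, where `P = ∫ √a dr`
is radial arclength, because `P ∘ ‖·‖` is `1`-Lipschitz (`ball_subset_shell`). In a shell of radial
width `2 R` the bound `λ₁ ≥ 1 / (4 R²)` is a one-dimensional fact about the radial direction, in
which the area `4 π r²` of the spheres is nondecreasing.

It is proved with a comparison field. Put `k = 1 / (2 R)` and let `τ ∈ (0, 2 R)` be the arclength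
from the inner edge of the shell. The function `F = k tan (k τ)` is finite and nonnegative because
`k τ < 1 < π / 2`, and `dF/dτ = k² + F²`. The field `F n`, with `n = x / ‖x‖`, has Euclidean
divergence `dF/dr + 2 F / r ≥ (k² + F²) √a`. Integrating the divergence of `|φ|² F n` for a test
function `φ` and completing a square bounds `k² ∫ |φ|² dV` by the integral of the squared radial
derivative, hence by `∫ |dφ|² dV` (`sum_pderiv_flux`, `norm_sq_le_sum_pderiv_flux`,
`integral_norm_sq_le_of_isTest`).

Only `Re (conj φ dφ)` enters, so `dφ` may be replaced by `dφ - φ W` for any purely imaginary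
covector field `W`. The inequality passes to `H¹₀` by `L²` convergence (`integral_norm_sq_le`).
With `W = 0` it bounds Rayleigh quotients and, testing a weak eigenfunction against itself, all
Dirichlet eigenvalues. If `W / i` is the real covector field whose components in the frame are the
mean momenta, divided by `ħ`, then `ħ² ∫ |dψ - ψ W|² dV` is the momentum variance of `ψ`
(`sq_le_momentumVar`).
-/

/-! ### Geodesic balls of a continuous metric -/

namespace Riem

variable {U : Set E3} {g : E3 → Matrix (Fin 3) (Fin 3) ℝ}

theorem geodBall_subset (x : E3) (r : ℝ) : geodBall U g x r ⊆ U := by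
  rintro y ⟨γ, -, hU, -, rfl, -⟩
  exact hU (by simp)

theorem mem_geodBall_self {x : E3} (hx : x ∈ U) {r : ℝ} (hr : 0 < r) : x ∈ geodBall U g x r := by
  refine ⟨fun _ => x, contDiffOn_const, fun _ _ => hx, rfl, rfl, ?_⟩
  simpa [curveLength, metricNorm, metricInner] using hr

theorem continuousOn_metricNorm (hg : ∀ i j, ContinuousOn (fun x => g x i j) U) :
    ContinuousOn (fun p : E3 × E3 => metricNorm g p.1 p.2) (U ×ˢ univ) := by
  unfold metricNorm metricInner
  refine ContinuousOn.sqrt ?_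
  refine continuousOn_finsetSum _ fun i _ => continuousOn_finsetSum _ fun j _ => ?_
  refine ContinuousOn.mul (ContinuousOn.mul ?_ (by fun_prop)) (by fun_prop)
  exact (hg i j).comp continuousOn_fst fun p hp => hp.1

/-- A curve that reaches `y` is moved to one that reaches `y + d` by adding `t • d`; its length
depends continuously on `d`. -/
theorem isOpen_geodBall (hU : IsOpen U) (hg : ∀ i j, ContinuousOn (fun x => g x i j) U)
    (x : E3) (r : ℝ) : IsOpen (geodBall U g x r) := by
  rw [isOpen_iff_mem_nhds]
  rintro y ⟨γ, hγ, hγU, h0, h1, hlen⟩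
  have hγc : ContinuousOn γ (Icc 0 1) := hγ.continuousOn
  have hγ'c : ContinuousOn (derivWithin γ (Icc 0 1)) (Icc 0 1) :=
    hγ.continuousOn_derivWithin (uniqueDiffOn_Icc one_pos) le_rfl
  have hK : IsCompact (γ '' Icc 0 1) := isCompact_Icc.image_of_continuousOn hγc
  obtain ⟨ε, hε, hεU⟩ := hK.exists_cthickening_subset_open hU hγU.image_subset
  have hmem : ∀ d : E3, ‖d‖ ≤ ε → ∀ t ∈ Icc (0 : ℝ) 1, γ t + t • d ∈ U := by
    intro d hd t ht
    refine hεU (Metric.mem_cthickening_of_dist_le _ (γ t) _ _ (mem_image_of_mem _ ht) ?_)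
    rw [dist_eq_norm, add_sub_cancel_left, norm_smul, Real.norm_of_nonneg ht.1]
    exact (mul_le_of_le_one_left (norm_nonneg d) ht.2).trans hd
  -- The projection to `[0, 1]` makes the integrand continuous in all real `t`.
  let L : Metric.closedBall (0 : E3) ε → ℝ := fun d => ∫ t in (0 : ℝ)..1,
    metricNorm g (γ (projIcc 0 1 zero_le_one t) + (projIcc (0 : ℝ) 1 zero_le_one t : ℝ) • (d : E3))
      (derivWithin γ (Icc 0 1) (projIcc (0 : ℝ) 1 zero_le_one t) + (d : E3))
  have hp : Continuous fun q : Metric.closedBall (0 : E3) ε × ℝ =>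
      (projIcc (0 : ℝ) 1 zero_le_one q.2 : ℝ) :=
    continuous_subtype_val.comp (continuous_projIcc.comp continuous_snd)
  have hL : Continuous L := by
    refine intervalIntegral.continuous_parametric_intervalIntegral_of_continuous' ?_ 0 1
    refine (continuousOn_metricNorm hg).comp_continuous
      (f := fun q : Metric.closedBall (0 : E3) ε × ℝ =>
        ((γ (projIcc 0 1 zero_le_one q.2) + (projIcc (0 : ℝ) 1 zero_le_one q.2 : ℝ) • (q.1 : E3),
        derivWithin γ (Icc 0 1) (projIcc (0 : ℝ) 1 zero_le_one q.2) + (q.1 : E3)) : E3 × E3))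
      ?_ ?_
    · refine Continuous.prodMk (Continuous.add ?_ (hp.smul ?_)) (Continuous.add ?_ ?_)
      · exact hγc.comp_continuous hp fun q => (projIcc (0 : ℝ) 1 zero_le_one q.2).2
      · exact continuous_subtype_val.comp continuous_fst
      · exact hγ'c.comp_continuous hp fun q => (projIcc (0 : ℝ) 1 zero_le_one q.2).2
      · exact continuous_subtype_val.comp continuous_fst
    · intro q
      exact ⟨hmem _ (mem_closedBall_zero_iff.1 q.1.2) _
        (projIcc (0 : ℝ) 1 zero_le_one q.2).2, mem_univ _⟩
  have hLeq : ∀ d : Metric.closedBall (0 : E3) ε,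
      curveLength g (fun t => γ t + t • (d : E3)) = L d := by
    intro d
    refine intervalIntegral.integral_congr fun t ht => ?_
    rw [uIcc_of_le zero_le_one] at ht
    have hd : derivWithin (fun t => γ t + t • (d : E3)) (Icc 0 1) t
        = derivWithin γ (Icc 0 1) t + d := by
      have h1 := ((hγ.differentiableOn one_ne_zero) t ht).hasDerivWithinAt.add
        (((hasDerivAt_id t).smul_const (d : E3)).hasDerivWithinAt (s := Icc 0 1))
      rw [one_smul] at h1
      exact h1.derivWithin (uniqueDiffOn_Icc one_pos t ht)
    simp only [hd, projIcc_of_mem zero_le_one ht]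
  have hL0 : L ⟨0, by simp [hε.le]⟩ < r := by
    rw [← hLeq]
    simpa using hlen
  have hev : ∀ᶠ d : Metric.closedBall (0 : E3) ε in 𝓝 ⟨0, by simp [hε.le]⟩, L d < r :=
    hL.continuousAt.eventually_lt_const hL0
  obtain ⟨δ, hδ, hball⟩ := Metric.eventually_nhds_iff.1 hev
  refine Metric.mem_nhds_iff.2 ⟨min δ ε, lt_min hδ hε, fun z hz => ?_⟩
  have hz' : ‖z - y‖ < min δ ε := by simpa [dist_eq_norm] using hz
  have hzε : ‖z - y‖ ≤ ε := (hz'.trans_le (min_le_right _ _)).le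
  refine ⟨fun t => γ t + t • (z - y), hγ.add (by fun_prop), hmem _ hzε, by simp [h0],
    by simp [h1], ?_⟩
  have := hball (y := ⟨z - y, by simpa using hzε⟩)
    (by rw [Subtype.dist_eq, dist_eq_norm]; simpa using hz'.trans_le (min_le_left _ _))
  rwa [← hLeq] at this

end Riem

namespace AdmissibleSlice

variable {S : BlackHole} (T : AdmissibleSlice S)

/-! ### The radial metric -/

theorem norm_pos {x : E3} (hx : x ∈ T.extSlice) : 0 < ‖x‖ := T.rIn_nonneg.trans_lt hx

theorem slice_subset_extSlice : T.slice ⊆ T.extSlice := fun _ hx => T.rIn_lt.trans hx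

theorem isOpen_extSlice : IsOpen T.extSlice := isOpen_lt continuous_const continuous_norm

theorem radial_norm_pos {x : E3} (hx : x ∈ T.extSlice) : 0 < T.radial ‖x‖ := T.radial_pos _ hx

theorem continuousOn_radial_norm : ContinuousOn (fun x : E3 => T.radial ‖x‖) T.extSlice :=
  T.radial_contDiffOn.continuousOn.comp continuous_norm.continuousOn fun _ hx => hx

theorem continuousOn_metric (i j : Fin 3) : ContinuousOn (fun x => T.metric x i j) T.extSlice := by
  unfold metric
  refine continuousOn_const.add (ContinuousOn.div ?_ (by fun_prop) ?_)
  · exact (T.continuousOn_radial_norm.sub continuousOn_const).mul (by fun_prop)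
  · exact fun x hx => pow_ne_zero _ (T.norm_pos hx).ne'

theorem sum_sq_coord (x : E3) : x 0 ^ 2 + x 1 ^ 2 + x 2 ^ 2 = ‖x‖ ^ 2 := by
  rw [EuclideanSpace.real_norm_sq_eq, Fin.sum_univ_three]

theorem metricInner_metric (x v : E3) : Riem.metricInner T.metric x v v
    = ‖v‖ ^ 2 + (T.radial ‖x‖ - 1) * inner ℝ x v ^ 2 / ‖x‖ ^ 2 := by
  rw [← sum_sq_coord v]
  simp only [Riem.metricInner, metric, PiLp.inner_apply, Fin.sum_univ_three]
  simp
  ring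

theorem radial_mul_le_metricInner {x : E3} (hx : x ∈ T.extSlice) (v : E3) :
    T.radial ‖x‖ * (inner ℝ x v / ‖x‖) ^ 2 ≤ Riem.metricInner T.metric x v v := by
  have hx0 := T.norm_pos hx
  have h : (inner ℝ x v / ‖x‖) ^ 2 ≤ ‖v‖ ^ 2 := by
    rw [div_pow, div_le_iff₀ (by positivity), ← mul_pow, mul_comm]
    exact sq_le_sq' (by linarith [neg_le_of_abs_le (abs_real_inner_le_norm x v)])
      (real_inner_le_norm x v)
  rw [metricInner_metric]
  have : (T.radial ‖x‖ - 1) * inner ℝ x v ^ 2 / ‖x‖ ^ 2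
    = (T.radial ‖x‖ - 1) * (inner ℝ x v / ‖x‖) ^ 2 := by rw [div_pow]; ring
  rw [this]
  linarith

theorem det_metric {x : E3} (hx : x ∈ T.extSlice) : (T.metric x).det = T.radial ‖x‖ := by
  have hx0 := T.norm_pos hx
  have h := sum_sq_coord x
  rw [Matrix.det_fin_three]
  simp [metric]
  field_simp
  simp only [show ‖x‖ ^ 6 = (‖x‖ ^ 2) ^ 3 by ring, ← h]
  ring

/-- The inverse metric `1 + (1/a - 1) n nᵀ`, where `n = x / ‖x‖` and `a = radial ‖x‖`. -/
theorem inv_metric {x : E3} (hx : x ∈ T.extSlice) : (T.metric x)⁻¹ = Matrix.of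
    fun i j => (if i = j then 1 else 0) + ((T.radial ‖x‖)⁻¹ - 1) * (x i * x j) / ‖x‖ ^ 2 := by
  have hx0 := T.norm_pos hx
  have ha := T.radial_norm_pos hx
  have h := sum_sq_coord x
  refine Matrix.inv_eq_right_inv ?_
  ext i j
  fin_cases i <;> fin_cases j <;>
    simp [Matrix.mul_apply, Fin.sum_univ_three, metric] <;> field_simp <;>
    simp only [show ‖x‖ ^ 4 = (‖x‖ ^ 2) ^ 2 by ring, ← h] <;> ring

/-! ### Radial arclength -/

/-- The arclength `∫ √a dr` along the radial geodesics, measured from the horizon `r = rPlus`. -/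
noncomputable def arclength (r : ℝ) : ℝ := ∫ s in S.rPlus..r, √(T.radial s)

theorem hasDerivAt_arclength {r : ℝ} (hr : T.rIn < r) :
    HasDerivAt T.arclength (√(T.radial r)) r := by
  have hc : ContinuousOn (fun s => √(T.radial s)) (Ioi T.rIn) :=
    T.radial_contDiffOn.continuousOn.sqrt
  refine intervalIntegral.integral_hasDerivAt_right ?_ ?_ (hc.continuousAt (Ioi_mem_nhds hr))
  · refine (hc.mono fun s hs => ?_).intervalIntegrable
    exact (lt_min T.rIn_lt hr).trans_le hs.1
  · exact hc.stronglyMeasurableAtFilter isOpen_Ioi r hr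

/-- The points whose radial arclength differs from that of `x` by less than `R`. -/
def shell (x : E3) (R : ℝ) : Set E3 :=
  {y | y ∈ T.extSlice ∧ |T.arclength ‖y‖ - T.arclength ‖x‖| < R}

/-- Radial arclength is a `1`-Lipschitz function on the slice. -/
theorem abs_arclength_sub_le_curveLength {γ : ℝ → E3} (hγ : ContDiffOn ℝ 1 γ (Icc 0 1))
    (hγU : MapsTo γ (Icc 0 1) T.extSlice) :
    |T.arclength ‖γ 1‖ - T.arclength ‖γ 0‖| ≤ Riem.curveLength T.metric γ := by
  have hγ'c : ContinuousOn (derivWithin γ (Icc 0 1)) (Icc 0 1) :=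
    hγ.continuousOn_derivWithin (uniqueDiffOn_Icc one_pos) le_rfl
  have hderiv : ∀ t ∈ Ioo (0 : ℝ) 1, HasDerivAt (fun t => T.arclength ‖γ t‖)
      (√(T.radial ‖γ t‖) * (inner ℝ (γ t) (derivWithin γ (Icc 0 1) t) / ‖γ t‖)) t := by
    intro t ht
    have htU := hγU (Ioo_subset_Icc_self ht)
    have hn : Icc (0 : ℝ) 1 ∈ 𝓝 t := Icc_mem_nhds ht.1 ht.2
    have h1 : HasDerivAt γ (derivWithin γ (Icc 0 1) t) t :=
      (((hγ.differentiableOn one_ne_zero) t (Ioo_subset_Icc_self ht)).hasDerivWithinAt).hasDerivAt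
        hn
    have h2 := h1.norm_sq.sqrt (pow_ne_zero 2 (T.norm_pos htU).ne')
    simp only [Real.sqrt_sq (norm_nonneg _)] at h2
    have h3 := (T.hasDerivAt_arclength htU).comp t h2
    refine h3.congr_deriv ?_
    congr 1
    exact mul_div_mul_left _ _ two_ne_zero
  have hNc : ContinuousOn (fun t => Riem.metricNorm T.metric (γ t) (derivWithin γ (Icc 0 1) t))
      (Icc 0 1) := by
    have h := (Riem.continuousOn_metricNorm T.continuousOn_metric).comp
      (hγ.continuousOn.prodMk hγ'c) (fun t ht => mk_mem_prod (hγU ht) (mem_univ _))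
    exact h
  have hint : IntervalIntegrable
      (fun t => Riem.metricNorm T.metric (γ t) (derivWithin γ (Icc 0 1) t)) volume 0 1 :=
    hNc.intervalIntegrable_of_Icc zero_le_one
  have hcont : ContinuousOn (fun t => T.arclength ‖γ t‖) (Icc 0 1) := fun t ht =>
    ContinuousAt.comp_continuousWithinAt (g := T.arclength) (f := fun t => ‖γ t‖)
      (T.hasDerivAt_arclength (hγU ht)).continuousAt (hγ.continuousOn t ht).norm
  have hbound : ∀ t ∈ Ioo (0 : ℝ) 1,
      |√(T.radial ‖γ t‖) * (inner ℝ (γ t) (derivWithin γ (Icc 0 1) t) / ‖γ t‖)|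
        ≤ Riem.metricNorm T.metric (γ t) (derivWithin γ (Icc 0 1) t) := by
    intro t ht
    have htU := hγU (Ioo_subset_Icc_self ht)
    refine Real.abs_le_sqrt ?_
    rw [mul_pow, Real.sq_sqrt (T.radial_norm_pos htU).le]
    exact T.radial_mul_le_metricInner htU _
  have hint' : IntervalIntegrable (fun t => √(T.radial ‖γ t‖) *
      (inner ℝ (γ t) (derivWithin γ (Icc 0 1) t) / ‖γ t‖)) volume 0 1 := by
    refine ContinuousOn.intervalIntegrable_of_Icc zero_le_one ?_
    refine ContinuousOn.mul ?_ (ContinuousOn.div (hγ.continuousOn.inner hγ'c)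
      hγ.continuousOn.norm fun t ht => (T.norm_pos (hγU ht)).ne')
    exact (T.continuousOn_radial_norm.comp hγ.continuousOn hγU).sqrt
  have hFTC := intervalIntegral.integral_eq_sub_of_hasDerivAt_of_le zero_le_one hcont hderiv hint'
  rw [← hFTC, ← Real.norm_eq_abs]
  refine intervalIntegral.norm_integral_le_of_norm_le zero_le_one ?_ hint
  filter_upwards [compl_mem_ae_iff.2 (measure_singleton (1 : ℝ))] with t ht1 ht
  exact hbound t ⟨ht.1, lt_of_le_of_ne ht.2 ht1⟩

theorem ball_subset_shell (x : E3) (R : ℝ) : T.ball x R ⊆ T.shell x R := by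
  rintro y ⟨γ, hγ, hγU, h0, h1, hlen⟩
  have h := (T.abs_arclength_sub_le_curveLength hγ hγU).trans_lt hlen
  rw [h0, h1] at h
  exact ⟨Riem.geodBall_subset x R ⟨γ, hγ, hγU, h0, h1, hlen⟩, h⟩

end AdmissibleSlice

namespace AdmissibleSlice

variable {S : BlackHole} (T : AdmissibleSlice S) {𝕜 : Type*} [RCLike 𝕜]

/-! ### Covectors -/

/-- The component `ξ(n)` of a covector along the Euclidean unit radial vector `n = x / ‖x‖`. -/
noncomputable def radialPart (x : E3) (ξ : Fin 3 → 𝕜) : 𝕜 := ∑ j, ((x j / ‖x‖ : ℝ) : 𝕜) * ξ j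

/-- The square root `1 + (1/√a - 1) n nᵀ` of the inverse metric, applied to a covector. It turns
the length of covectors into the Euclidean norm, so that `L²` spaces of covector fields become
ordinary `L²` spaces. -/
noncomputable def whiten (x : E3) (ξ : Fin 3 → 𝕜) : EuclideanSpace 𝕜 (Fin 3) :=
  WithLp.toLp 2 fun i =>
    ξ i + (((√(T.radial ‖x‖))⁻¹ - 1 : ℝ) : 𝕜) * radialPart x ξ * ((x i / ‖x‖ : ℝ) : 𝕜)

theorem radialPart_sub (x : E3) (ξ η : Fin 3 → 𝕜) :
    radialPart x (ξ - η) = radialPart x ξ - radialPart x η := by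
  simp [radialPart, mul_sub, Finset.sum_sub_distrib]

theorem radialPart_smul (x : E3) (c : 𝕜) (ξ : Fin 3 → 𝕜) :
    radialPart x (c • ξ) = c * radialPart x ξ := by
  simp only [radialPart, Finset.mul_sum, Pi.smul_apply, smul_eq_mul]
  exact Finset.sum_congr rfl fun j _ => by ring

theorem whiten_sub (x : E3) (ξ η : Fin 3 → 𝕜) :
    T.whiten x (ξ - η) = T.whiten x ξ - T.whiten x η := by
  ext i
  simp only [whiten, radialPart_sub, Pi.sub_apply, PiLp.sub_apply]
  ring

theorem whiten_smul (x : E3) (c : 𝕜) (ξ : Fin 3 → 𝕜) :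
    T.whiten x (c • ξ) = c • T.whiten x ξ := by
  ext i
  simp only [whiten, radialPart_smul, Pi.smul_apply, PiLp.smul_apply, smul_eq_mul]
  ring

theorem sum_sq_unit {x : E3} (hx : 0 < ‖x‖) :
    (x 0 / ‖x‖) ^ 2 + (x 1 / ‖x‖) ^ 2 + (x 2 / ‖x‖) ^ 2 = 1 := by
  have h := sum_sq_coord x
  field_simp
  exact h

theorem inv_metric_apply {x : E3} (hx : x ∈ T.extSlice) (i j : Fin 3) : (T.metric x)⁻¹ i j =
    (if i = j then 1 else 0)
      + ((√(T.radial ‖x‖))⁻¹ ^ 2 - 1) * ((x i / ‖x‖) * (x j / ‖x‖)) := by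
  rw [T.inv_metric hx, inv_pow, Real.sq_sqrt (T.radial_norm_pos hx).le, Matrix.of_apply]
  ring

theorem coNormSq_metric {x : E3} (hx : x ∈ T.extSlice) (ξ : Fin 3 → 𝕜) :
    Riem.coNormSq T.metric x ξ = ‖T.whiten x ξ‖ ^ 2 := by
  have h := sum_sq_unit (T.norm_pos hx)
  rw [EuclideanSpace.norm_sq_eq]
  simp only [Riem.coNormSq, T.inv_metric_apply hx, whiten, radialPart, Fin.sum_univ_three,
    RCLike.norm_sq_eq_def, map_add, RCLike.mul_re, RCLike.mul_im, RCLike.ofReal_re,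
    RCLike.ofReal_im, RCLike.star_def, RCLike.conj_re, RCLike.conj_im]
  simp [-inv_pow]
  generalize x 0 / ‖x‖ = n0 at *
  generalize x 1 / ‖x‖ = n1 at *
  generalize x 2 / ‖x‖ = n2 at *
  generalize (√(T.radial ‖x‖))⁻¹ = b
  rw [← eq_sub_iff_add_eq] at h
  generalize RCLike.re (ξ 0) = p0
  generalize RCLike.re (ξ 1) = p1
  generalize RCLike.re (ξ 2) = p2
  generalize RCLike.im (ξ 0) = q0
  generalize RCLike.im (ξ 1) = q1
  generalize RCLike.im (ξ 2) = q2
  linear_combination (-(b - 1) ^ 2 * ((n0 * p0 + n1 * p1 + n2 * p2) ^ 2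
    + (n0 * q0 + n1 * q1 + n2 * q2) ^ 2)) * h

theorem coInner_metric {x : E3} (hx : x ∈ T.extSlice) (ξ η : Fin 3 → ℝ) :
    Riem.coInner T.metric x ξ η = inner ℝ (T.whiten x ξ) (T.whiten x η) := by
  have h := sum_sq_unit (T.norm_pos hx)
  simp only [Riem.coInner, T.inv_metric_apply hx, whiten, radialPart, Fin.sum_univ_three,
    PiLp.inner_apply]
  simp [-inv_pow]
  generalize x 0 / ‖x‖ = n0 at *
  generalize x 1 / ‖x‖ = n1 at *
  generalize x 2 / ‖x‖ = n2 at *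
  generalize (√(T.radial ‖x‖))⁻¹ = b
  linear_combination (-(b - 1) ^ 2 * ((n0 * ξ 0 + n1 * ξ 1 + n2 * ξ 2)
    * (n0 * η 0 + n1 * η 1 + n2 * η 2))) * h

theorem coNormSq_nonneg {x : E3} (hx : x ∈ T.extSlice) (ξ : Fin 3 → 𝕜) :
    0 ≤ Riem.coNormSq T.metric x ξ := by
  rw [T.coNormSq_metric hx]
  positivity

theorem sq_norm_radialPart_le {x : E3} (hx : x ∈ T.extSlice) (ξ : Fin 3 → 𝕜) :
    ‖radialPart x ξ‖ ^ 2 ≤ T.radial ‖x‖ * Riem.coNormSq T.metric x ξ := by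
  have h := sum_sq_unit (T.norm_pos hx)
  have ha := T.radial_norm_pos hx
  have hC : ((∑ j, ((x j / ‖x‖) ^ 2 : ℝ) : ℝ) : 𝕜) = 1 := by
    rw [Fin.sum_univ_three, h, RCLike.ofReal_one]
  let n : EuclideanSpace 𝕜 (Fin 3) := WithLp.toLp 2 fun j => ((x j / ‖x‖ : ℝ) : 𝕜)
  have hn : ‖n‖ = 1 := by
    have : ‖n‖ ^ 2 = 1 := by
      rw [EuclideanSpace.norm_sq_eq, ← h, Fin.sum_univ_three]
      simp only [n, RCLike.norm_ofReal, sq_abs]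
    exact (pow_eq_one_iff_of_nonneg (norm_nonneg _) two_ne_zero).1 this
  have h1 : inner 𝕜 n (T.whiten x ξ) = (((√(T.radial ‖x‖))⁻¹ : ℝ) : 𝕜) * radialPart x ξ := by
    have : inner 𝕜 n (T.whiten x ξ) = radialPart x ξ
        + (((√(T.radial ‖x‖))⁻¹ - 1 : ℝ) : 𝕜) * radialPart x ξ
          * ((∑ j, ((x j / ‖x‖) ^ 2 : ℝ) : ℝ) : 𝕜) := by
      simp only [n, whiten, PiLp.inner_apply, RCLike.inner_apply, RCLike.conj_ofReal,
        Fin.sum_univ_three]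
      conv_lhs => simp only [radialPart, Fin.sum_univ_three]
      conv_rhs => simp only [radialPart, Fin.sum_univ_three]
      push_cast
      ring
    rw [this, hC]
    push_cast
    ring
  have h2 := norm_inner_le_norm (𝕜 := 𝕜) n (T.whiten x ξ)
  rw [h1, hn, one_mul, norm_mul, RCLike.norm_ofReal, abs_of_nonneg (by positivity)] at h2
  rw [T.coNormSq_metric hx, ← Real.sq_sqrt ha.le, ← mul_pow]
  have h3 : 0 < √(T.radial ‖x‖) := Real.sqrt_pos.2 ha
  rw [inv_mul_le_iff₀ h3] at h2
  gcongr

end AdmissibleSlice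

/-! ### Integrals of divergences -/

namespace Riem

variable {𝕜 : Type*} [RCLike 𝕜]

theorem integral_pderiv_eq_zero {h : E3 → ℝ} (hh : ContDiff ℝ 1 h) (hc : HasCompactSupport h)
    (i : Fin 3) : ∫ x, pderiv i h x = 0 := by
  have h1 : Continuous (pderiv i h) := (hh.continuous_fderiv one_ne_zero).clm_apply
    continuous_const
  have h2 : HasCompactSupport (pderiv i h) := hc.fderiv_apply ℝ _
  have := integral_mul_fderiv_eq_neg_fderiv_mul_of_integrable (μ := volume) (f := fun _ => 1)
    (g := h) (v := EuclideanSpace.single i 1) (by simp)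
    (by simp only [one_mul]; exact h1.integrable_of_hasCompactSupport h2)
    (by simp only [one_mul]; exact hh.continuous.integrable_of_hasCompactSupport hc)
    (fun _ _ => differentiableAt_const _)
    (fun x _ => hh.differentiable one_ne_zero x)
  simpa [pderiv] using this

theorem integrable_pderiv {h : E3 → ℝ} (hh : ContDiff ℝ 1 h) (hc : HasCompactSupport h)
    (i : Fin 3) : Integrable (pderiv i h) :=
  ((hh.continuous_fderiv one_ne_zero).clm_apply
    continuous_const).integrable_of_hasCompactSupport (hc.fderiv_apply ℝ _)

theorem eq_sum_single (x : E3) : x = ∑ i, x i • EuclideanSpace.single i (1 : ℝ) := by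
  ext j
  simp [Fin.sum_univ_three]
  fin_cases j <;> simp

theorem sum_coord_smul_pderiv {F : Type*} [NormedAddCommGroup F] [NormedSpace ℝ F]
    (φ : E3 → F) (x v : E3) : ∑ i, v i • pderiv i φ x = fderiv ℝ φ x v := by
  conv_rhs => rw [eq_sum_single v]
  simp [pderiv, map_sum]

theorem hasFDerivAt_norm_sq {φ : E3 → 𝕜} {x : E3} {L : E3 →L[ℝ] 𝕜} (h : HasFDerivAt φ L x) :
    ∃ L' : E3 →L[ℝ] ℝ, HasFDerivAt (fun y => ‖φ y‖ ^ 2) L' x ∧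
      ∀ v, L' v = 2 * RCLike.re (star (φ x) * L v) := by
  have hre := (RCLike.reCLM (K := 𝕜)).hasFDerivAt.comp x h
  have him := (RCLike.imCLM (K := 𝕜)).hasFDerivAt.comp x h
  have := (hre.pow 2).add (him.pow 2)
  refine ⟨_, this.congr_of_eventuallyEq (.of_forall fun y => ?_), fun v => ?_⟩
  · simp only [RCLike.norm_sq_eq_def, ← sq]
    rfl
  · simp [RCLike.mul_re]
    ring

theorem contDiff_norm_sq {φ : E3 → 𝕜} (h : ContDiff ℝ ∞ φ) : ContDiff ℝ ∞ fun x => ‖φ x‖ ^ 2 := by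
  have hre := (RCLike.reCLM (K := 𝕜)).contDiff.comp h
  have him := (RCLike.imCLM (K := 𝕜)).contDiff.comp h
  simp only [RCLike.norm_sq_eq_def, ← sq]
  exact (hre.pow 2).add (him.pow 2)

theorem tsupport_norm_sq_subset (φ : E3 → 𝕜) : tsupport (fun x => ‖φ x‖ ^ 2) ⊆ tsupport φ :=
  closure_mono fun x hx h => hx (by simp [show φ x = 0 from h])

end Riem

namespace AdmissibleSlice

variable {S : BlackHole} (T : AdmissibleSlice S) {𝕜 : Type*} [RCLike 𝕜]

/-! ### The comparison vector field -/

/-- The radial component `k tan (k τ)`, with `k = 1 / (2 R)`, of the comparison field on the shell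
of radius `R` around `x`. Here `τ = P(s) - P(‖x‖) + R ∈ (0, 2 R)` is the radial arclength from the
inner edge of the shell, so that `k τ ∈ (0, 1)`. As a function of `τ` it solves the Riccati
equation `F' = k² + F²`. -/
noncomputable def comparison (x : E3) (R s : ℝ) : ℝ :=
  1 / (2 * R) * Real.tan (1 / (2 * R) * (T.arclength s - T.arclength ‖x‖ + R))

variable {T} {x₀ : E3} {R : ℝ}

theorem comparison_arg_mem (hR : 0 < R) {x : E3} (hx : x ∈ T.shell x₀ R) :
    1 / (2 * R) * (T.arclength ‖x‖ - T.arclength ‖x₀‖ + R) ∈ Ioo (0 : ℝ) 1 := by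
  have h := abs_lt.1 hx.2
  constructor
  · have : 0 < T.arclength ‖x‖ - T.arclength ‖x₀‖ + R := by linarith
    positivity
  · rw [one_div, inv_mul_lt_iff₀ (by positivity)]
    linarith

theorem cos_comparison_arg_pos (hR : 0 < R) {x : E3} (hx : x ∈ T.shell x₀ R) :
    0 < Real.cos (1 / (2 * R) * (T.arclength ‖x‖ - T.arclength ‖x₀‖ + R)) := by
  have h := comparison_arg_mem hR hx
  have := Real.pi_gt_three
  exact Real.cos_pos_of_mem_Ioo ⟨by linarith [h.1], by linarith [h.2]⟩

theorem comparison_nonneg (hR : 0 < R) {x : E3} (hx : x ∈ T.shell x₀ R) :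
    0 ≤ T.comparison x₀ R ‖x‖ := by
  have h := comparison_arg_mem hR hx
  have := Real.pi_gt_three
  exact mul_nonneg (by positivity)
    (Real.tan_nonneg_of_nonneg_of_le_pi_div_two h.1.le (by linarith [h.2]))

theorem hasDerivAt_comparison (hR : 0 < R) {x : E3} (hx : x ∈ T.shell x₀ R) :
    HasDerivAt (T.comparison x₀ R)
      (((1 / (2 * R)) ^ 2 + T.comparison x₀ R ‖x‖ ^ 2) * √(T.radial ‖x‖)) ‖x‖ := by
  have hcos := (cos_comparison_arg_pos hR hx).ne'
  have h1 := ((((T.hasDerivAt_arclength hx.1).sub_const (T.arclength ‖x₀‖)).add_const R).const_mul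
    (1 / (2 * R)))
  have h2 := ((Real.hasDerivAt_tan hcos).comp ‖x‖ h1).const_mul (1 / (2 * R))
  refine h2.congr_deriv ?_
  rw [comparison, ← Real.inv_one_add_tan_sq hcos, one_div (_⁻¹), inv_inv]
  ring

theorem contDiffAt_comparison (hR : 0 < R) {x : E3} (hx : x ∈ T.shell x₀ R) :
    ContDiffAt ℝ 1 (T.comparison x₀ R) ‖x‖ := by
  have hP : ContDiffOn ℝ 1 T.arclength (Ioi T.rIn) := by
    rw [show (1 : WithTop ℕ∞) = 0 + 1 by rfl, contDiffOn_succ_iff_deriv_of_isOpen isOpen_Ioi]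
    refine ⟨fun s hs => (T.hasDerivAt_arclength hs).differentiableAt.differentiableWithinAt,
      by simp, ?_⟩
    rw [contDiffOn_zero]
    exact T.radial_contDiffOn.continuousOn.sqrt.congr fun s hs => (T.hasDerivAt_arclength hs).deriv
  have hPx : ContDiffAt ℝ 1 T.arclength ‖x‖ := hP.contDiffAt (Ioi_mem_nhds hx.1)
  have harg : ContDiffAt ℝ 1
      (fun s => 1 / (2 * R) * (T.arclength s - T.arclength ‖x₀‖ + R)) ‖x‖ :=
    contDiffAt_const.mul ((hPx.sub contDiffAt_const).add contDiffAt_const)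
  exact contDiffAt_const.mul (ContDiffAt.comp (g := Real.tan) ‖x‖
    (Real.contDiffAt_tan.2 (cos_comparison_arg_pos hR hx).ne') harg)

/-- The `i`-th component of the comparison field `F(‖x‖) x / ‖x‖`, multiplied by `|φ|²`. -/
noncomputable def flux (T : AdmissibleSlice S) (x₀ : E3) (R : ℝ) (φ : E3 → 𝕜) (i : Fin 3)
    (x : E3) : ℝ :=
  ‖φ x‖ ^ 2 * (T.comparison x₀ R ‖x‖ / ‖x‖ * x i)

theorem tsupport_flux_subset (φ : E3 → 𝕜) (i : Fin 3) :
    tsupport (T.flux x₀ R φ i) ⊆ tsupport φ :=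
  (tsupport_mul_subset_left (f := fun x => ‖φ x‖ ^ 2)).trans (Riem.tsupport_norm_sq_subset φ)

theorem contDiff_flux (hR : 0 < R) {φ : E3 → 𝕜} (hφ : Riem.IsTest (T.shell x₀ R) φ) (i : Fin 3) :
    ContDiff ℝ 1 (T.flux x₀ R φ i) := by
  refine contDiff_iff_contDiffAt.2 fun x => ?_
  by_cases hx : x ∈ tsupport (T.flux x₀ R φ i)
  swap
  · exact contDiffAt_const.congr_of_eventuallyEq (notMem_tsupport_iff_eventuallyEq.1 hx)
  have hxV := hφ.2.2 (tsupport_flux_subset φ i hx)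
  have hx0 : x ≠ 0 := norm_pos_iff.1 (T.norm_pos hxV.1)
  have hnorm : ContDiffAt ℝ 1 (fun y : E3 => ‖y‖) x := contDiffAt_norm ℝ hx0
  have hcoord : ContDiffAt ℝ 1 (fun y : E3 => y i) x := by fun_prop
  have h1 : ContDiffAt ℝ 1 (fun y : E3 => T.comparison x₀ R ‖y‖) x :=
    ContDiffAt.comp (g := T.comparison x₀ R) (f := fun y : E3 => ‖y‖) x
      (contDiffAt_comparison hR hxV) hnorm
  exact ((Riem.contDiff_norm_sq hφ.1).contDiffAt.of_le (by simp)).mul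
    ((h1.div hnorm (norm_ne_zero_iff.2 hx0)).mul hcoord)

theorem sum_pderiv_flux (hR : 0 < R) {φ : E3 → 𝕜} (hφ : Differentiable ℝ φ) {x : E3}
    (hx : x ∈ T.shell x₀ R) :
    ∑ i, Riem.pderiv i (T.flux x₀ R φ i) x =
      2 * RCLike.re (star (φ x) * radialPart x (Riem.differential φ x)) * T.comparison x₀ R ‖x‖
      + ‖φ x‖ ^ 2 * (((1 / (2 * R)) ^ 2 + T.comparison x₀ R ‖x‖ ^ 2) * √(T.radial ‖x‖)
        + 2 * T.comparison x₀ R ‖x‖ / ‖x‖) := by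
  have hpos := T.norm_pos hx.1
  obtain ⟨L, hL, hLv⟩ := Riem.hasFDerivAt_norm_sq (hφ x).hasFDerivAt
  have hnorm : HasFDerivAt (fun y : E3 => ‖y‖) (‖x‖⁻¹ • innerSL ℝ x) x := by
    have h := ((hasStrictFDerivAt_norm_sq x).hasFDerivAt.sqrt (pow_ne_zero 2 hpos.ne'))
    simp only [Real.sqrt_sq (norm_nonneg _)] at h
    refine h.congr_fderiv ?_
    ext v
    simp
    field_simp
  have hq := ((hasDerivAt_comparison hR hx).div (hasDerivAt_id ‖x‖) hpos.ne').comp_hasFDerivAt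
    x hnorm
  have hi : ∀ i, Riem.pderiv i (T.flux x₀ R φ i) x =
      L (EuclideanSpace.single i 1) * (T.comparison x₀ R ‖x‖ / ‖x‖ * x i)
      + ‖φ x‖ ^ 2 * ((((1 / (2 * R)) ^ 2 + T.comparison x₀ R ‖x‖ ^ 2) * √(T.radial ‖x‖) * ‖x‖
        - T.comparison x₀ R ‖x‖) / ‖x‖ ^ 2 * (x i / ‖x‖) * x i + T.comparison x₀ R ‖x‖ / ‖x‖) := by
    intro i
    have hc : HasFDerivAt (fun y : E3 => y i) (EuclideanSpace.proj i : E3 →L[ℝ] ℝ) x :=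
      (EuclideanSpace.proj i : E3 →L[ℝ] ℝ).hasFDerivAt
    have h := hL.mul (hq.mul hc)
    have h' : HasFDerivAt (T.flux x₀ R φ i) _ x := h
    rw [Riem.pderiv, h'.fderiv]
    simp [EuclideanSpace.inner_single_right]
    ring
  have hLx : ∑ i, x i * L (EuclideanSpace.single i 1)
      = 2 * RCLike.re (star (φ x) * radialPart x (Riem.differential φ x)) * ‖x‖ := by
    have h1 : ∑ i, x i * L (EuclideanSpace.single i 1) = L x := by
      conv_rhs => rw [Riem.eq_sum_single x]
      simp [map_sum]
    have h2 : fderiv ℝ φ x x = (‖x‖ : 𝕜) * radialPart x (Riem.differential φ x) := by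
      rw [← Riem.sum_coord_smul_pderiv, radialPart, Finset.mul_sum]
      refine Finset.sum_congr rfl fun i _ => ?_
      rw [← mul_assoc, ← RCLike.ofReal_mul, mul_div_cancel₀ _ hpos.ne', RCLike.real_smul_eq_coe_mul]
      rfl
    rw [h1, hLv, h2, mul_left_comm, RCLike.re_ofReal_mul]
    ring
  have hs := sum_sq_coord x
  simp only [hi]
  rw [Fin.sum_univ_three] at hLx ⊢
  have hre : 2 * RCLike.re (star (φ x) * radialPart x (Riem.differential φ x))
      = (x 0 * L (EuclideanSpace.single 0 1) + x 1 * L (EuclideanSpace.single 1 1)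
        + x 2 * L (EuclideanSpace.single 2 1)) / ‖x‖ := by
    rw [hLx]
    field_simp
  rw [hre]
  have hs' : x 0 ^ 2 = ‖x‖ ^ 2 - x 1 ^ 2 - x 2 ^ 2 := by linarith
  field_simp
  ring_nf
  simp only [hs']
  ring

end AdmissibleSlice

namespace AdmissibleSlice

variable {S : BlackHole} {T : AdmissibleSlice S} {𝕜 : Type*} [RCLike 𝕜] {B : Set E3}

/-! ### The Riemannian volume -/

theorem vol_metric (hB : IsOpen B) (hBU : B ⊆ T.extSlice) : Riem.vol T.metric B =
    (volume.restrict B).withDensity fun x => ENNReal.ofReal (√(T.radial ‖x‖)) := by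
  refine withDensity_congr_ae ?_
  filter_upwards [ae_restrict_mem hB.measurableSet] with x hx
  rw [T.det_metric (hBU hx)]

theorem ae_vol_mem (hB : IsOpen B) : ∀ᵐ x ∂(Riem.vol T.metric B), x ∈ B :=
  (withDensity_absolutelyContinuous _ _).ae_le (ae_restrict_mem hB.measurableSet)

theorem aestronglyMeasurable_vol {F : Type*} [TopologicalSpace F]
    [TopologicalSpace.PseudoMetrizableSpace F] (hB : IsOpen B)
    {f : E3 → F} (hf : ContinuousOn f B) [SecondCountableTopologyEither E3 F] :
    AEStronglyMeasurable f (Riem.vol T.metric B) :=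
  (hf.aestronglyMeasurable hB.measurableSet).mono_ac (withDensity_absolutelyContinuous _ _)

theorem aemeasurable_density (hB : IsOpen B) (hBU : B ⊆ T.extSlice) :
    AEMeasurable (fun x => ENNReal.ofReal (√(T.radial ‖x‖))) (volume.restrict B) :=
  (((T.continuousOn_radial_norm.mono hBU).sqrt).aemeasurable hB.measurableSet).ennreal_ofReal

theorem integrable_vol_iff (hB : IsOpen B) (hBU : B ⊆ T.extSlice) (f : E3 → ℝ) :
    Integrable f (Riem.vol T.metric B) ↔ IntegrableOn (fun x => √(T.radial ‖x‖) * f x) B := by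
  rw [vol_metric hB hBU, integrable_withDensity_iff_integrable_smul₀'
    (aemeasurable_density hB hBU) (by simp)]
  simp [IntegrableOn]

theorem integral_vol (hB : IsOpen B) (hBU : B ⊆ T.extSlice) (f : E3 → ℝ) :
    ∫ x, f x ∂(Riem.vol T.metric B) = ∫ x in B, √(T.radial ‖x‖) * f x := by
  rw [vol_metric hB hBU, integral_withDensity_eq_integral_toReal_smul₀
    (aemeasurable_density hB hBU) (by simp)]
  simp

theorem integrable_vol_of_tsupport (hB : IsOpen B) (hBU : B ⊆ T.extSlice) {f : E3 → ℝ}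
    (hf : Continuous f) (hc : HasCompactSupport f) (hfB : tsupport f ⊆ B) :
    Integrable f (Riem.vol T.metric B) := by
  rw [integrable_vol_iff hB hBU]
  refine Integrable.integrableOn (Continuous.integrable_of_hasCompactSupport ?_ hc.mul_left)
  refine ContinuousOn.continuous_of_tsupport_subset (s := B) ?_ hB
    ((tsupport_mul_subset_right (f := fun x => √(T.radial ‖x‖))).trans hfB)
  exact (T.continuousOn_radial_norm.mono hBU).sqrt.mul hf.continuousOn

theorem memLp_vol_of_tsupport {F : Type*} [NormedAddCommGroup F] [SecondCountableTopology F]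
    (hB : IsOpen B) (hBU : B ⊆ T.extSlice) {f : E3 → F}
    (hf : Continuous f) (hc : HasCompactSupport f) (hfB : tsupport f ⊆ B) :
    MemLp f 2 (Riem.vol T.metric B) := by
  have hsub : tsupport (fun x => ‖f x‖ ^ 2) ⊆ tsupport f :=
    closure_mono fun x hx h => hx (by simp [show f x = 0 from h])
  rw [memLp_two_iff_integrable_sq_norm (aestronglyMeasurable_vol hB hf.continuousOn)]
  exact integrable_vol_of_tsupport hB hBU (by fun_prop)
    (hc.mono' (subset_closure.trans hsub)) (hsub.trans hfB)

/-! ### The inequality for test functions -/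

theorem norm_sq_le_sum_pderiv_flux {x₀ : E3} {R : ℝ} (hR : 0 < R) {φ : E3 → 𝕜}
    (hφ : Differentiable ℝ φ) {x : E3} (hx : x ∈ T.shell x₀ R) (W : Fin 3 → 𝕜)
    (hW : ∀ i, RCLike.re (W i) = 0) :
    √(T.radial ‖x‖) * ((1 / (2 * R)) ^ 2 * ‖φ x‖ ^ 2) ≤
      ∑ i, Riem.pderiv i (T.flux x₀ R φ i) x + √(T.radial ‖x‖) *
        Riem.coNormSq T.metric x (Riem.differential φ x - φ x • W) := by
  rw [sum_pderiv_flux hR hφ hx]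
  set F := T.comparison x₀ R ‖x‖
  have hF : 0 ≤ F := comparison_nonneg hR hx
  have hs := T.norm_pos hx.1
  have hC := T.coNormSq_nonneg hx.1 (Riem.differential φ x - φ x • W)
  have hy := T.sq_norm_radialPart_le hx.1 (Riem.differential φ x - φ x • W)
  set C := Riem.coNormSq T.metric x (Riem.differential φ x - φ x • W)
  have hw : RCLike.re (radialPart x W) = 0 := by
    simp [radialPart, hW, -map_div₀]
  rw [← Real.sq_sqrt (T.radial_norm_pos hx.1).le, ← Real.sq_sqrt hC, ← mul_pow] at hy
  have hm : 0 < √(T.radial ‖x‖) := Real.sqrt_pos.2 (T.radial_norm_pos hx.1)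
  set m := √(T.radial ‖x‖)
  have hy' := (pow_le_pow_iff_left₀ (norm_nonneg _) (by positivity) two_ne_zero).1 hy
  -- A purely imaginary `W` does not contribute to `Re (conj φ · dφ)`.
  have hre : RCLike.re (star (φ x) * radialPart x (Riem.differential φ x))
      = RCLike.re (star (φ x) * radialPart x (Riem.differential φ x - φ x • W)) := by
    rw [radialPart_sub, radialPart_smul, mul_sub, map_sub, ← mul_assoc, RCLike.star_def,
      RCLike.conj_mul, ← RCLike.ofReal_pow, RCLike.re_ofReal_mul, hw, mul_zero, sub_zero]
  have hlow : -(‖φ x‖ * (m * √C))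
      ≤ RCLike.re (star (φ x) * radialPart x (Riem.differential φ x)) := by
    rw [hre]
    refine (neg_le_neg ?_).trans (neg_le_of_abs_le (RCLike.abs_re_le_norm _))
    rw [norm_mul, norm_star]
    gcongr
  have h1 : -(‖φ x‖ * (m * √C)) * (2 * F)
      ≤ RCLike.re (star (φ x) * radialPart x (Riem.differential φ x)) * (2 * F) := by gcongr
  have h2 : 0 ≤ ‖φ x‖ ^ 2 * (2 * F / ‖x‖) := by positivity
  -- This square absorbs the cross term of the divergence; `h2` drops the growth of the spheres.
  have h3 : 0 ≤ m * (‖φ x‖ * F - √C) ^ 2 := by positivity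
  have h4 : √C ^ 2 = C := Real.sq_sqrt hC
  nlinarith [h1, h2, h3, h4]

/-- The Poincaré inequality with a magnetic potential `W`, for test functions. The divergence of
the flux integrates to zero. -/
theorem integral_norm_sq_le_of_isTest {x₀ : E3} {R : ℝ} (hR : 0 < R) (hB : IsOpen B)
    (hBV : B ⊆ T.shell x₀ R) {φ : E3 → 𝕜} (hφ : Riem.IsTest B φ) (W : E3 → Fin 3 → 𝕜)
    (hW : ∀ x i, RCLike.re (W x i) = 0)
    (hint : Integrable (fun x => Riem.coNormSq T.metric x (Riem.differential φ x - φ x • W x))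
      (Riem.vol T.metric B)) :
    (1 / (2 * R)) ^ 2 * ∫ x, ‖φ x‖ ^ 2 ∂(Riem.vol T.metric B) ≤
      ∫ x, Riem.coNormSq T.metric x (Riem.differential φ x - φ x • W x)
        ∂(Riem.vol T.metric B) := by
  have hBU : B ⊆ T.extSlice := fun x hx => (hBV hx).1
  have hφV : Riem.IsTest (T.shell x₀ R) φ := ⟨hφ.1, hφ.2.1, hφ.2.2.trans hBV⟩
  have hcs : ∀ i, HasCompactSupport (T.flux x₀ R φ i) := fun i =>
    hφ.2.1.mono' (subset_closure.trans (tsupport_flux_subset φ i))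
  have hD : Integrable fun x => ∑ i, Riem.pderiv i (T.flux x₀ R φ i) x :=
    integrable_finsetSum _ fun i _ => Riem.integrable_pderiv (contDiff_flux hR hφV i) (hcs i) i
  have hD0 : ∫ x in B, ∑ i, Riem.pderiv i (T.flux x₀ R φ i) x = 0 := by
    rw [setIntegral_eq_integral_of_forall_compl_eq_zero]
    · rw [integral_finsetSum _ fun i _ => Riem.integrable_pderiv (contDiff_flux hR hφV i) (hcs i) i]
      exact Finset.sum_eq_zero fun i _ =>
        Riem.integral_pderiv_eq_zero (contDiff_flux hR hφV i) (hcs i) i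
    · intro x hx
      refine Finset.sum_eq_zero fun i _ => ?_
      have : x ∉ tsupport (T.flux x₀ R φ i) := fun h =>
        hx (hφ.2.2 (tsupport_flux_subset φ i h))
      rw [Riem.pderiv, fderiv_of_notMem_tsupport ℝ this, zero_apply]
  have hφ2 : Integrable (fun x => (1 / (2 * R)) ^ 2 * ‖φ x‖ ^ 2) (Riem.vol T.metric B) :=
    ((memLp_two_iff_integrable_sq_norm (aestronglyMeasurable_vol hB
      hφ.1.continuous.continuousOn)).1 (memLp_vol_of_tsupport hB hBU hφ.1.continuous hφ.2.1
        hφ.2.2)).const_mul _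
  rw [← integral_const_mul, integral_vol hB hBU, integral_vol hB hBU]
  rw [integrable_vol_iff hB hBU] at hint hφ2
  have hsum := integral_add hD.integrableOn hint
  rw [hD0, zero_add] at hsum
  rw [← hsum]
  exact setIntegral_mono_on hφ2 (hD.integrableOn.add hint) hB.measurableSet fun x hx =>
    norm_sq_le_sum_pderiv_flux hR (hφ.1.differentiable (by simp)) (hBV hx) (W x) (hW x)

end AdmissibleSlice

/-! ### Convergence in `L²` -/

section L2

variable {α : Type*} [MeasurableSpace α] {m : Measure α} {𝕜 E : Type*} [RCLike 𝕜]
  [NormedAddCommGroup E] [InnerProductSpace 𝕜 E]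

theorem MeasureTheory.MemLp.inner_toLp {f g : α → E} (hf : MemLp f 2 m) (hg : MemLp g 2 m) :
    inner 𝕜 (hf.toLp f) (hg.toLp g) = ∫ x, inner 𝕜 (f x) (g x) ∂m := by
  rw [L2.inner_def]
  refine integral_congr_ae ?_
  filter_upwards [hf.coeFn_toLp, hg.coeFn_toLp] with x h1 h2
  rw [h1, h2]

theorem tendsto_integral_inner {f g : ℕ → α → E} {f₀ g₀ : α → E} (hf : ∀ n, MemLp (f n) 2 m)
    (hg : ∀ n, MemLp (g n) 2 m) (hf₀ : MemLp f₀ 2 m) (hg₀ : MemLp g₀ 2 m)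
    (hfl : Tendsto (fun n => eLpNorm (f n - f₀) 2 m) atTop (𝓝 0))
    (hgl : Tendsto (fun n => eLpNorm (g n - g₀) 2 m) atTop (𝓝 0)) :
    Tendsto (fun n => ∫ x, inner 𝕜 (f n x) (g n x) ∂m) atTop
      (𝓝 (∫ x, inner 𝕜 (f₀ x) (g₀ x) ∂m)) := by
  have h1 := (Lp.tendsto_Lp_iff_tendsto_eLpNorm'' f hf f₀ hf₀).2 hfl
  have h2 := (Lp.tendsto_Lp_iff_tendsto_eLpNorm'' g hg g₀ hg₀).2 hgl
  simp only [← (hf _).inner_toLp (𝕜 := 𝕜) (hg _), ← hf₀.inner_toLp (𝕜 := 𝕜) hg₀]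
  exact h1.inner h2

end L2

theorem tendsto_integral_norm_sq {α : Type*} [MeasurableSpace α] {m : Measure α} (𝕜 : Type*)
    {E : Type*} [RCLike 𝕜] [NormedAddCommGroup E] [InnerProductSpace 𝕜 E] {f : ℕ → α → E} {f₀ : α → E} (hf : ∀ n, MemLp (f n) 2 m)
    (hf₀ : MemLp f₀ 2 m) (hfl : Tendsto (fun n => eLpNorm (f n - f₀) 2 m) atTop (𝓝 0)) :
    Tendsto (fun n => ∫ x, ‖f n x‖ ^ 2 ∂m) atTop (𝓝 (∫ x, ‖f₀ x‖ ^ 2 ∂m)) := by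
  have h := (RCLike.continuous_re.tendsto _).comp
    (tendsto_integral_inner (𝕜 := 𝕜) hf hf hf₀ hf₀ hfl hfl)
  simp only [inner_self_eq_norm_sq_to_K, ← RCLike.ofReal_pow, Function.comp_def] at h
  simpa only [integral_ofReal, RCLike.ofReal_re] using h

theorem eLpNorm_two_eq_lintegral_rpow {α F : Type*} [MeasurableSpace α] {m : Measure α}
    [NormedAddCommGroup F] (f : α → F) :
    eLpNorm f 2 m = (∫⁻ x, ENNReal.ofReal (‖f x‖ ^ 2) ∂m) ^ (1 / 2 : ℝ) := by
  rw [eLpNorm_eq_lintegral_rpow_enorm_toReal two_ne_zero ENNReal.ofNat_ne_top]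
  congr 1
  refine lintegral_congr fun x => ?_
  rw [ENNReal.ofReal_pow (norm_nonneg _), ofReal_norm]
  simp

theorem tendsto_eLpNorm_two_of_lintegral {α F : Type*} [MeasurableSpace α] {m : Measure α}
    [NormedAddCommGroup F] {f : ℕ → α → F}
    (h : Tendsto (fun n => ∫⁻ x, ENNReal.ofReal (‖f n x‖ ^ 2) ∂m) atTop (𝓝 0)) :
    Tendsto (fun n => eLpNorm (f n) 2 m) atTop (𝓝 0) := by
  simp only [eLpNorm_two_eq_lintegral_rpow]
  have := h.ennrpow_const (1 / 2)
  rwa [ENNReal.zero_rpow_of_pos (by norm_num)] at this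

namespace AdmissibleSlice

variable {S : BlackHole} {T : AdmissibleSlice S} {𝕜 : Type*} [RCLike 𝕜] {B : Set E3}

/-! ### The space `H¹₀` -/

theorem continuousOn_unit (hBU : B ⊆ T.extSlice) (i : Fin 3) :
    ContinuousOn (fun x : E3 => ((x i / ‖x‖ : ℝ) : 𝕜)) B :=
  RCLike.continuous_ofReal.comp_continuousOn
    (ContinuousOn.div (by fun_prop) continuous_norm.continuousOn fun x hx =>
      (T.norm_pos (hBU hx)).ne')

theorem continuousOn_whiten_coef (hBU : B ⊆ T.extSlice) :
    ContinuousOn (fun x : E3 => (((√(T.radial ‖x‖))⁻¹ - 1 : ℝ) : 𝕜)) B :=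
  RCLike.continuous_ofReal.comp_continuousOn
    ((((T.continuousOn_radial_norm.mono hBU).sqrt).inv₀ fun _ hx =>
      (Real.sqrt_pos.2 (T.radial_norm_pos (hBU hx))).ne').sub continuousOn_const)

theorem aestronglyMeasurable_whiten (hB : IsOpen B) (hBU : B ⊆ T.extSlice)
    {G : E3 → Fin 3 → 𝕜} (hG : AEStronglyMeasurable G (Riem.vol T.metric B)) :
    AEStronglyMeasurable (fun x => T.whiten x (G x)) (Riem.vol T.metric B) := by
  have hGi : ∀ i, AEStronglyMeasurable (fun x => G x i) (Riem.vol T.metric B) := fun i =>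
    (continuous_apply i).comp_aestronglyMeasurable hG
  have hn : ∀ i, AEStronglyMeasurable (fun x : E3 => ((x i / ‖x‖ : ℝ) : 𝕜))
      (Riem.vol T.metric B) := fun i => aestronglyMeasurable_vol hB (continuousOn_unit hBU i)
  have hc := aestronglyMeasurable_vol (T := T) hB (continuousOn_whiten_coef (𝕜 := 𝕜) hBU)
  refine (PiLp.continuous_toLp 2 fun _ : Fin 3 => 𝕜).comp_aestronglyMeasurable
    (aemeasurable_pi_lambda _ fun i => AEStronglyMeasurable.aemeasurable ?_).aestronglyMeasurable
  refine (hGi i).add ((hc.mul ?_).mul (hn i))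
  exact Finset.aestronglyMeasurable_fun_sum _ fun j _ => (hn j).mul (hGi j)

theorem continuousOn_whiten (hBU : B ⊆ T.extSlice) {G : E3 → Fin 3 → 𝕜}
    (hG : ContinuousOn G B) : ContinuousOn (fun x => T.whiten x (G x)) B := by
  have hGi : ∀ i, ContinuousOn (fun x => G x i) B := fun i =>
    (continuous_apply i).comp_continuousOn hG
  refine (PiLp.continuous_toLp 2 fun _ : Fin 3 => 𝕜).comp_continuousOn
    (continuousOn_pi.2 fun i => ?_)
  refine (hGi i).add (((continuousOn_whiten_coef hBU).mul ?_).mul (continuousOn_unit hBU i))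
  exact continuousOn_finsetSum _ fun j _ => (continuousOn_unit hBU j).mul (hGi j)

theorem memLp_whiten_differential (hB : IsOpen B) (hBU : B ⊆ T.extSlice) {φ : E3 → 𝕜}
    (hφ : Riem.IsTest B φ) :
    MemLp (fun x => T.whiten x (Riem.differential φ x)) 2 (Riem.vol T.metric B) := by
  have hd : Continuous (Riem.differential φ) := continuous_pi fun i =>
    (hφ.1.continuous_fderiv (by simp)).clm_apply continuous_const
  have hsub : tsupport (fun x => T.whiten x (Riem.differential φ x)) ⊆ tsupport φ := by
    refine closure_minimal (fun x hx => ?_) (isClosed_tsupport φ)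
    by_contra h
    refine hx ?_
    have : Riem.differential φ x = (0 : 𝕜) • (0 : Fin 3 → 𝕜) := by
      ext i
      simp [Riem.differential, Riem.pderiv, fderiv_of_notMem_tsupport ℝ h]
    change T.whiten x _ = 0
    rw [this, whiten_smul, zero_smul]
  refine memLp_vol_of_tsupport hB hBU ?_ (hφ.2.1.mono' (subset_closure.trans hsub))
    (hsub.trans hφ.2.2)
  exact (continuousOn_whiten hBU hd.continuousOn).continuous_of_tsupport_subset hB
    (hsub.trans hφ.2.2)

theorem memLp_of_isTest (hB : IsOpen B) (hBU : B ⊆ T.extSlice) {φ : E3 → 𝕜}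
    (hφ : Riem.IsTest B φ) : MemLp φ 2 (Riem.vol T.metric B) :=
  memLp_vol_of_tsupport hB hBU hφ.1.continuous hφ.2.1 hφ.2.2

/-- Membership in `H¹₀` in terms of `L²` convergence of whitened differentials. -/
theorem exists_tendsto_of_memH10 (hB : IsOpen B) (hBU : B ⊆ T.extSlice) {u : E3 → 𝕜}
    {G : E3 → Fin 3 → 𝕜} (h : Riem.MemH10 T.metric B u G) :
    MemLp (fun x => T.whiten x (G x)) 2 (Riem.vol T.metric B) ∧
    ∃ φ : ℕ → E3 → 𝕜, (∀ n, Riem.IsTest B (φ n)) ∧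
      Tendsto (fun n => eLpNorm (φ n - u) 2 (Riem.vol T.metric B)) atTop (𝓝 0) ∧
      Tendsto (fun n => eLpNorm ((fun x => T.whiten x (Riem.differential (φ n) x)) -
        fun x => T.whiten x (G x)) 2 (Riem.vol T.metric B)) atTop (𝓝 0) := by
  obtain ⟨-, hG, φ, hφ, h1, h2⟩ := h
  have hlim : Tendsto (fun n => eLpNorm ((fun x => T.whiten x (Riem.differential (φ n) x)) -
      fun x => T.whiten x (G x)) 2 (Riem.vol T.metric B)) atTop (𝓝 0) := by
    refine tendsto_eLpNorm_two_of_lintegral (h2.congr fun n => lintegral_congr_ae ?_)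
    filter_upwards [ae_vol_mem hB] with x hx
    rw [T.coNormSq_metric (hBU hx), whiten_sub]
    rfl
  refine ⟨?_, φ, hφ, tendsto_eLpNorm_two_of_lintegral h1, hlim⟩
  have hGm := aestronglyMeasurable_whiten hB hBU hG
  obtain ⟨n, hn⟩ := (hlim.eventually_lt_const ENNReal.zero_lt_top).exists
  have hd := memLp_whiten_differential hB hBU (hφ n)
  have := hd.sub (show MemLp _ 2 _ from ⟨hd.1.sub hGm, hn⟩)
  simpa using this

theorem integral_coNormSq (hB : IsOpen B) (hBU : B ⊆ T.extSlice) (G : E3 → Fin 3 → 𝕜) :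
    ∫ x, Riem.coNormSq T.metric x (G x) ∂(Riem.vol T.metric B)
      = ∫ x, ‖T.whiten x (G x)‖ ^ 2 ∂(Riem.vol T.metric B) := by
  refine integral_congr_ae ?_
  filter_upwards [ae_vol_mem hB] with x hx
  rw [T.coNormSq_metric (hBU hx)]

theorem integrable_coNormSq (hB : IsOpen B) (hBU : B ⊆ T.extSlice) {G : E3 → Fin 3 → 𝕜}
    (hG : MemLp (fun x => T.whiten x (G x)) 2 (Riem.vol T.metric B)) :
    Integrable (fun x => Riem.coNormSq T.metric x (G x)) (Riem.vol T.metric B) := by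
  refine (hG.integrable_norm_pow two_ne_zero).congr ?_
  filter_upwards [ae_vol_mem hB] with x hx
  rw [T.coNormSq_metric (hBU hx)]

/-- The Poincaré inequality on the shell with a bounded, purely imaginary potential `W`. For
`W = 0` it bounds Rayleigh quotients; a general `W` absorbs the mean momentum of a state. -/
theorem integral_norm_sq_le {x₀ : E3} {R : ℝ} (hR : 0 < R) (hB : IsOpen B)
    (hBV : B ⊆ T.shell x₀ R) {u : E3 → 𝕜} {G : E3 → Fin 3 → 𝕜}
    (h : Riem.MemH10 T.metric B u G) (W : E3 → Fin 3 → 𝕜) (hW : ∀ x i, RCLike.re (W x i) = 0)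
    (hWm : AEStronglyMeasurable W (Riem.vol T.metric B)) (C : ℝ)
    (hWC : ∀ x ∈ B, Riem.coNormSq T.metric x (W x) ≤ C) :
    (1 / (2 * R)) ^ 2 * ∫ x, ‖u x‖ ^ 2 ∂(Riem.vol T.metric B) ≤
      ∫ x, Riem.coNormSq T.metric x (G x - u x • W x) ∂(Riem.vol T.metric B) := by
  have hBU : B ⊆ T.extSlice := fun x hx => (hBV hx).1
  obtain ⟨hG, φ, hφ, hφl, hdl⟩ := exists_tendsto_of_memH10 hB hBU h
  have hu := h.1
  have hφm := fun n => memLp_of_isTest hB hBU (hφ n)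
  have hWw := aestronglyMeasurable_whiten hB hBU hWm
  have hbound : ∀ v : E3 → 𝕜, ∀ᵐ x ∂(Riem.vol T.metric B),
      ‖v x • T.whiten x (W x)‖ ≤ √C * ‖v x‖ := by
    intro v
    filter_upwards [ae_vol_mem hB] with x hx
    rw [norm_smul, mul_comm]
    refine mul_le_mul_of_nonneg_right (Real.le_sqrt_of_sq_le ?_) (norm_nonneg _)
    rw [← T.coNormSq_metric (hBU hx)]
    exact hWC x hx
  have hvW : ∀ {v : E3 → 𝕜}, MemLp v 2 (Riem.vol T.metric B) →
      MemLp (fun x => v x • T.whiten x (W x)) 2 (Riem.vol T.metric B) := fun {v} hv =>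
    hv.of_le_mul (hv.1.smul hWw) (hbound v)
  have hW0 : Tendsto (fun n => eLpNorm (fun x => (φ n - u) x • T.whiten x (W x)) 2
      (Riem.vol T.metric B)) atTop (𝓝 0) := by
    have h0 : Tendsto (fun n => ENNReal.ofReal (√C) * eLpNorm (φ n - u) 2 (Riem.vol T.metric B))
        atTop (𝓝 0) := by
      simpa using ENNReal.Tendsto.const_mul hφl (.inr ENNReal.ofReal_ne_top)
    exact tendsto_of_tendsto_of_tendsto_of_le_of_le tendsto_const_nhds h0 (fun _ => zero_le)
      fun n => eLpNorm_le_mul_eLpNorm_of_ae_le_mul (hbound _) 2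
  have hH : ∀ n, MemLp (fun x => T.whiten x (Riem.differential (φ n) x - φ n x • W x)) 2
      (Riem.vol T.metric B) := by
    intro n
    simp only [whiten_sub, whiten_smul]
    exact (memLp_whiten_differential hB hBU (hφ n)).sub (hvW (hφm n))
  have hH₀ : MemLp (fun x => T.whiten x (G x - u x • W x)) 2 (Riem.vol T.metric B) := by
    simp only [whiten_sub, whiten_smul]
    exact hG.sub (hvW hu)
  have hHl : Tendsto (fun n => eLpNorm
      ((fun x => T.whiten x (Riem.differential (φ n) x - φ n x • W x)) -
        fun x => T.whiten x (G x - u x • W x)) 2 (Riem.vol T.metric B)) atTop (𝓝 0) := by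
    have hadd := hdl.add hW0
    rw [add_zero] at hadd
    refine tendsto_of_tendsto_of_tendsto_of_le_of_le tendsto_const_nhds hadd (fun _ => zero_le)
      fun n => ?_
    have heq : ((fun x => T.whiten x (Riem.differential (φ n) x - φ n x • W x)) -
        fun x => T.whiten x (G x - u x • W x)) =
        ((fun x => T.whiten x (Riem.differential (φ n) x)) - fun x => T.whiten x (G x)) -
          fun x => (φ n - u) x • T.whiten x (W x) := by
      ext1 x
      simp only [whiten_sub, whiten_smul, Pi.sub_apply, sub_smul]
      abel
    rw [heq]
    exact eLpNorm_sub_le ((memLp_whiten_differential hB hBU (hφ n)).1.sub hG.1)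
      (hvW ((hφm n).sub hu)).1 one_le_two
  rw [integral_coNormSq hB hBU fun x => G x - u x • W x]
  refine le_of_tendsto_of_tendsto'
    ((tendsto_integral_norm_sq 𝕜 hφm hu hφl).const_mul _)
    (tendsto_integral_norm_sq 𝕜 hH hH₀ hHl) fun n => ?_
  rw [← integral_coNormSq hB hBU fun x => Riem.differential (φ n) x - φ n x • W x]
  exact integral_norm_sq_le_of_isTest hR hB hBV (hφ n) W hW (integrable_coNormSq hB hBU (hH n))

/-! ### Dirichlet eigenvalues -/

theorem integral_sq_le_integral_coNormSq {x₀ : E3} {R : ℝ} (hR : 0 < R) (hB : IsOpen B)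
    (hBV : B ⊆ T.shell x₀ R) {u : E3 → ℝ} {G : E3 → Fin 3 → ℝ}
    (h : Riem.MemH10 T.metric B u G) :
    1 / (4 * R ^ 2) * ∫ x, u x ^ 2 ∂(Riem.vol T.metric B) ≤
      ∫ x, Riem.coNormSq T.metric x (G x) ∂(Riem.vol T.metric B) := by
  have := integral_norm_sq_le hR hB hBV h (fun _ => 0) (by simp) aestronglyMeasurable_const 0
    (by simp [Riem.coNormSq])
  simp only [Real.norm_eq_abs, sq_abs, smul_zero, sub_zero] at this
  convert! this using 2
  ring

theorem integral_sq_pos {m : Measure E3} {u : E3 → ℝ} (h : ∫ x, u x ^ 2 ∂m ≠ 0) :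
    0 < ∫ x, u x ^ 2 ∂m :=
  lt_of_le_of_ne (integral_nonneg fun _ => sq_nonneg _) h.symm

/-- The infimum defining `lambda1` is over a nonempty set: a bump function is in `H¹₀`. -/
theorem exists_memH10 (hB : IsOpen B) (hBU : B ⊆ T.extSlice) (hne : B.Nonempty) :
    ∃ (u : E3 → ℝ) (G : E3 → Fin 3 → ℝ), Riem.MemH10 T.metric B u G ∧
      (∫ x, u x ^ 2 ∂(Riem.vol T.metric B)) ≠ 0 := by
  obtain ⟨x, hx⟩ := hne
  obtain ⟨φ, hsupp, hcomp, hsmooth, -, hφx⟩ :=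
    exists_contDiff_tsupport_subset (n := ⊤) (hB.mem_nhds hx)
  have hφ : Riem.IsTest B φ := ⟨hsmooth, hcomp, hsupp⟩
  have hd : Continuous (Riem.differential φ) := continuous_pi fun i =>
    (hφ.1.continuous_fderiv (by simp)).clm_apply continuous_const
  refine ⟨φ, Riem.differential φ, ⟨memLp_of_isTest hB hBU hφ,
    aestronglyMeasurable_vol hB hd.continuousOn, fun _ => φ, fun _ => hφ, by simp,
    by simp [Riem.coNormSq]⟩, ?_⟩
  have hc : Continuous fun x => √(T.radial ‖x‖) * φ x ^ 2 := by
    refine ContinuousOn.continuous_of_tsupport_subset (s := B) ?_ hB ?_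
    · exact (T.continuousOn_radial_norm.mono hBU).sqrt.mul (hφ.1.continuous.pow 2).continuousOn
    · have hsq : tsupport (fun y => φ y ^ 2) ⊆ tsupport φ :=
        closure_mono fun y hy hy0 => hy (by simp [show φ y = 0 from hy0])
      exact (tsupport_mul_subset_right (f := fun x => √(T.radial ‖x‖))).trans (hsq.trans hsupp)
  have hcs : HasCompactSupport fun x => √(T.radial ‖x‖) * φ x ^ 2 :=
    hcomp.mono fun y hy hy0 => hy (by simp [show φ y = 0 from hy0])
  rw [integral_vol hB hBU, setIntegral_eq_integral_of_forall_compl_eq_zero]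
  · refine (hc.integral_pos_of_hasCompactSupport_nonneg_nonzero hcs
      (fun y => by positivity) (x := x) ?_).ne'
    simp [hφx, (Real.sqrt_pos.2 (T.radial_norm_pos (hBU hx))).ne']
  · intro y hy
    have : φ y = 0 := image_eq_zero_of_notMem_tsupport fun h => hy (hsupp h)
    simp [this]

theorem le_lambda1 {x₀ : E3} {R : ℝ} (hR : 0 < R) (hB : IsOpen B)
    (hBV : B ⊆ T.shell x₀ R) (hne : B.Nonempty) :
    1 / (4 * R ^ 2) ≤ Riem.lambda1 T.metric B := by
  obtain ⟨u, G, hu, hu0⟩ := exists_memH10 hB (fun x hx => (hBV hx).1) hne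
  refine le_csInf ⟨_, u, G, hu, hu0, rfl⟩ ?_
  rintro _ ⟨v, H, hv, hv0, rfl⟩
  rw [le_div_iff₀ (integral_sq_pos hv0)]
  exact integral_sq_le_integral_coNormSq hR hB hBV hv

/-- A weak eigenfunction `u` may be tested against itself, so that `μ` is its Rayleigh quotient. -/
theorem le_of_isDirichletEigenvalue {x₀ : E3} {R : ℝ} (hR : 0 < R) (hB : IsOpen B)
    (hBV : B ⊆ T.shell x₀ R) {μ : ℝ} (hμ : Riem.IsDirichletEigenvalue T.metric B μ) :
    1 / (4 * R ^ 2) ≤ μ := by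
  have hBU : B ⊆ T.extSlice := fun x hx => (hBV hx).1
  obtain ⟨u, G, hu, hu0, hweak⟩ := hμ
  obtain ⟨hG, φ, hφ, hφl, hdl⟩ := exists_tendsto_of_memH10 hB hBU hu
  have hconst : ∀ {E : Type} [NormedAddCommGroup E] (f : E3 → E),
      Tendsto (fun _ : ℕ => eLpNorm (f - f) 2 (Riem.vol T.metric B)) atTop (𝓝 0) := by
    intro E _ f
    simp
  have h1 := tendsto_integral_inner (𝕜 := ℝ) (fun _ => hG)
    (fun n => memLp_whiten_differential hB hBU (hφ n)) hG hG (hconst _) hdl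
  have h2 := (tendsto_integral_inner (𝕜 := ℝ) (fun n => memLp_of_isTest hB hBU (hφ n))
    (fun _ => hu.1) hu.1 hu.1 hφl (hconst _)).const_mul μ
  have heq : ∀ n, ∫ x, inner ℝ (T.whiten x (G x)) (T.whiten x (Riem.differential (φ n) x))
      ∂(Riem.vol T.metric B) = μ * ∫ x, inner ℝ (φ n x) (u x) ∂(Riem.vol T.metric B) := by
    intro n
    have := hweak (φ n) (hφ n)
    simp only [RCLike.inner_apply, conj_trivial]
    rw [← this]
    refine integral_congr_ae ?_
    filter_upwards [ae_vol_mem hB] with x hx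
    rw [T.coInner_metric (hBU hx)]
  have hlim := tendsto_nhds_unique (h1.congr heq) h2
  simp only [real_inner_self_eq_norm_sq, Real.norm_eq_abs, sq_abs] at hlim
  rw [← integral_coNormSq hB hBU] at hlim
  have hray := integral_sq_le_integral_coNormSq hR hB hBV hu
  rw [hlim] at hray
  exact le_of_mul_le_mul_right hray (integral_sq_pos hu0)

/-! ### Orthonormal frames and momentum -/

theorem inv_eq_of_orthonormal {g : E3 → Matrix (Fin 3) (Fin 3) ℝ} {x : E3} {e : Fin 3 → E3}
    (he : ∀ a b, Riem.metricInner g x (e a) (e b) = if a = b then 1 else 0) (i j : Fin 3) :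
    (g x)⁻¹ i j = ∑ a, e a i * e a j := by
  let M : Matrix (Fin 3) (Fin 3) ℝ := Matrix.of fun a i => e a i
  have h1 : M * (g x * M.transpose) = 1 := by
    ext a b
    rw [Matrix.one_apply, ← he a b]
    simp only [M, Matrix.mul_apply, Riem.metricInner, Matrix.transpose_apply, Matrix.of_apply,
      Finset.mul_sum]
    exact Finset.sum_congr rfl fun i _ => Finset.sum_congr rfl fun j _ => by ring
  have h2 : g x * (M.transpose * M) = 1 := by
    rw [← Matrix.mul_assoc]
    exact mul_eq_one_comm.1 h1
  rw [Matrix.inv_eq_right_inv h2]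
  simp [M, Matrix.mul_apply]

theorem coNormSq_eq_sum_frame {g : E3 → Matrix (Fin 3) (Fin 3) ℝ} {x : E3} {e : Fin 3 → E3}
    (he : ∀ a b, Riem.metricInner g x (e a) (e b) = if a = b then 1 else 0) (ξ : Fin 3 → ℂ) :
    Riem.coNormSq g x ξ = ∑ a, ‖∑ i, (e a i : ℂ) * ξ i‖ ^ 2 := by
  simp only [Riem.coNormSq, inv_eq_of_orthonormal he, ← Complex.normSq_eq_norm_sq,
    Complex.normSq_apply, Fin.sum_univ_three]
  simp
  ring

theorem norm_sub_I_mul_sq (D z : ℂ) (p : ℝ) : ‖D - z * (Complex.I * p)‖ ^ 2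
    = ‖D‖ ^ 2 - 2 * p * (star z * (-Complex.I * D)).re + p ^ 2 * ‖z‖ ^ 2 := by
  simp only [← Complex.normSq_eq_norm_sq, Complex.normSq_apply]
  simp
  ring

/-- The mean momenta `p_a`, in units of `ħ`, define the real covector field `A` with
`A(e_a) = p_a`, and the momentum variance of a normalized `ψ` is `ħ² ∫ |dψ - i ψ A|²`. -/
theorem sq_le_momentumVar {x₀ : E3} {R : ℝ} (hR : 0 < R) (hB : IsOpen B)
    (hBV : B ⊆ T.shell x₀ R) (hbar : ℝ) {e : Fin 3 → E3 → E3}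
    (he : Riem.IsOrthonormalFrame T.metric B e) {ψ : E3 → ℂ} {G : E3 → Fin 3 → ℂ}
    (h : Riem.MemH10 T.metric B ψ G) (hψ : ∫ y, ‖ψ y‖ ^ 2 ∂(Riem.vol T.metric B) = 1) :
    (hbar * (1 / (2 * R))) ^ 2 ≤ Riem.momentumVar T.metric B hbar e ψ G := by
  have hBU : B ⊆ T.extSlice := fun x hx => (hBV hx).1
  obtain ⟨hG, -⟩ := exists_tendsto_of_memH10 hB hBU h
  let D : Fin 3 → E3 → ℂ := fun a x => ∑ i, (e a x i : ℂ) * G x i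
  have hGi : ∀ i, AEStronglyMeasurable (fun x => G x i) (Riem.vol T.metric B) := fun i =>
    (continuous_apply i).comp_aestronglyMeasurable h.2.1
  have hei : ∀ a i, ContinuousOn (fun x => (e a x i : ℂ)) B := fun a i =>
    Complex.continuous_ofReal.comp_continuousOn
      ((EuclideanSpace.proj i : E3 →L[ℝ] ℝ).continuous.comp_continuousOn (he.1 a))
  have hD : ∀ a, MemLp (D a) 2 (Riem.vol T.metric B) := by
    intro a
    refine hG.of_le (Finset.aestronglyMeasurable_fun_sum _ fun i _ =>
      (aestronglyMeasurable_vol hB (hei a i)).mul (hGi i)) ?_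
    filter_upwards [ae_vol_mem hB] with x hx
    refine (pow_le_pow_iff_left₀ (norm_nonneg _) (norm_nonneg _) two_ne_zero).1 ?_
    rw [← T.coNormSq_metric (hBU hx), coNormSq_eq_sum_frame (he.2 x hx)]
    exact Finset.single_le_sum (f := fun a => ‖D a x‖ ^ 2) (fun b _ => by positivity)
      (Finset.mem_univ a)
  have hint : ∀ a, Integrable (fun x => star (ψ x) * (-Complex.I * D a x))
      (Riem.vol T.metric B) := fun a => h.1.star.integrable_mul ((hD a).const_mul _)
  let p : Fin 3 → ℝ := fun a => (∫ x, star (ψ x) * (-Complex.I * D a x) ∂(Riem.vol T.metric B)).re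
  let W : E3 → Fin 3 → ℂ := fun x i =>
    Complex.I * ((∑ a, p a * ∑ j, T.metric x i j * e a x j : ℝ) : ℂ)
  have heW : ∀ x ∈ B, ∀ a, ∑ i, (e a x i : ℂ) * W x i = Complex.I * p a := by
    intro x hx a
    have h1 : ∑ i, e a x i * ∑ b, p b * ∑ j, T.metric x i j * e b x j = p a := by
      have h2 : ∑ b, p b * Riem.metricInner T.metric x (e a x) (e b x) = p a := by
        simp [he.2 x hx]
      rw [← h2]
      simp only [Riem.metricInner, Fin.sum_univ_three]
      ring
    rw [← h1, Complex.ofReal_sum, Finset.mul_sum]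
    refine Finset.sum_congr rfl fun i _ => ?_
    simp only [W, Complex.ofReal_mul]
    ring
  have hWm : AEStronglyMeasurable W (Riem.vol T.metric B) := by
    refine aestronglyMeasurable_vol hB (continuousOn_pi.2 fun i => continuousOn_const.mul
      (Complex.continuous_ofReal.comp_continuousOn ?_))
    refine continuousOn_finsetSum _ fun a _ => continuousOn_const.mul
      (continuousOn_finsetSum _ fun j _ => ((T.continuousOn_metric i j).mono hBU).mul ?_)
    exact (EuclideanSpace.proj j : E3 →L[ℝ] ℝ).continuous.comp_continuousOn (he.1 a)
  have key := integral_norm_sq_le hR hB hBV h W (by simp [W]) hWm (∑ a, p a ^ 2)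
    fun x hx => by
      rw [coNormSq_eq_sum_frame (he.2 x hx)]
      simp [heW x hx]
  have hexp : ∀ a, ∫ x, ‖D a x - ψ x * (Complex.I * p a)‖ ^ 2 ∂(Riem.vol T.metric B)
      = (∫ x, ‖D a x‖ ^ 2 ∂(Riem.vol T.metric B)) - p a ^ 2 := by
    intro a
    have hre : ∫ x, (star (ψ x) * (-Complex.I * D a x)).re ∂(Riem.vol T.metric B) = p a :=
      integral_re (hint a)
    simp only [norm_sub_I_mul_sq]
    rw [integral_add, integral_sub, integral_const_mul, integral_const_mul, hre, hψ]
    · ring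
    · exact (hD a).integrable_norm_pow two_ne_zero
    · exact (hint a).re.const_mul _
    · exact ((hD a).integrable_norm_pow two_ne_zero).sub ((hint a).re.const_mul _)
    · exact (h.1.integrable_norm_pow two_ne_zero).const_mul _
  have hsum : ∫ x, Riem.coNormSq T.metric x (G x - ψ x • W x) ∂(Riem.vol T.metric B)
      = ∑ a, ((∫ x, ‖D a x‖ ^ 2 ∂(Riem.vol T.metric B)) - p a ^ 2) := by
    simp only [← hexp]
    rw [← integral_finsetSum]
    · refine integral_congr_ae ?_
      filter_upwards [ae_vol_mem hB] with x hx
      rw [coNormSq_eq_sum_frame (he.2 x hx)]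
      refine Finset.sum_congr rfl fun a _ => ?_
      rw [← heW x hx a, Finset.mul_sum, ← Finset.sum_sub_distrib]
      congr 2
      refine Finset.sum_congr rfl fun i _ => ?_
      simp only [Pi.sub_apply, Pi.smul_apply, smul_eq_mul]
      ring
    · intro a _
      exact ((hD a).sub (h.1.mul_const _)).integrable_norm_pow two_ne_zero
  have hvar : Riem.momentumVar T.metric B hbar e ψ G
      = hbar ^ 2 * ∑ a, ((∫ x, ‖D a x‖ ^ 2 ∂(Riem.vol T.metric B)) - p a ^ 2) := by
    rw [Riem.momentumVar, Finset.mul_sum]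
    refine Finset.sum_congr rfl fun a _ => ?_
    have h1 : ∀ x, ‖Riem.momentum hbar (e a) G x‖ ^ 2 = hbar ^ 2 * ‖D a x‖ ^ 2 := by
      intro x
      simp [Riem.momentum, D, mul_pow]
    have h2 : ∀ x, star (ψ x) * Riem.momentum hbar (e a) G x
        = (hbar : ℂ) * (star (ψ x) * (-Complex.I * D a x)) := by
      intro x
      simp only [Riem.momentum, D]
      ring
    simp only [h1, h2, integral_const_mul, Complex.re_ofReal_mul]
    rw [mul_pow, mul_sub]
  rw [hψ, mul_one, hsum] at key
  rw [hvar, mul_pow]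
  exact mul_le_mul_of_nonneg_left key (sq_nonneg _)

end AdmissibleSlice

/-! ### The bounds on the balls of the slice -/

theorem theorem1 (S : BlackHole) (T : AdmissibleSlice S) (rg : ℝ) (hrg : 0 < rg)
    (hball : ∀ x ∈ T.slice, Riem.BallWellDefined T.extSlice T.metric x rg)
    (hconv : ∀ x ∈ T.slice, Riem.StronglyConvexBall T.extSlice T.metric x rg) :
    (∀ x ∈ T.slice,
      1 / (4 * rg ^ 2) ≤ Riem.lambda1 T.metric (T.ball x rg) ∧
      ∀ μ, Riem.IsDirichletEigenvalue T.metric (T.ball x rg) μ → 1 / (4 * rg ^ 2) ≤ μ) ∧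
    1 / 2 ≤ T.c rg ∧
    ∀ x ∈ T.slice, ∀ hbar : ℝ, 0 < hbar →
      ∀ e : Fin 3 → E3 → E3, Riem.IsOrthonormalFrame T.metric (T.ball x rg) e →
      ∀ (ψ : E3 → ℂ) (G : E3 → Fin 3 → ℂ), Riem.MemH10 T.metric (T.ball x rg) ψ G →
        (∫ y, ‖ψ y‖ ^ 2 ∂(Riem.vol T.metric (T.ball x rg))) = 1 →
        hbar / 2 ≤ Riem.sigmaP T.metric (T.ball x rg) hbar e ψ G * rg := by
  have hopen : ∀ x, IsOpen (T.ball x rg) := fun x =>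
    Riem.isOpen_geodBall T.isOpen_extSlice T.continuousOn_metric x rg
  have hsub : ∀ x, T.ball x rg ⊆ T.shell x rg := fun x => T.ball_subset_shell x rg
  have hlam : ∀ x ∈ T.slice, 1 / (4 * rg ^ 2) ≤ Riem.lambda1 T.metric (T.ball x rg) :=
    fun x hx => AdmissibleSlice.le_lambda1 hrg (hopen x) (hsub x)
      ⟨x, Riem.mem_geodBall_self (T.slice_subset_extSlice hx) hrg⟩
  refine ⟨fun x hx => ⟨hlam x hx, fun μ hμ =>
    AdmissibleSlice.le_of_isDirichletEigenvalue hrg (hopen x) (hsub x) hμ⟩, ?_, ?_⟩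
  · have hne : Nonempty T.slice := by
      refine ⟨EuclideanSpace.single 0 (S.rPlus + 1), ?_⟩
      change S.rPlus < ‖EuclideanSpace.single (0 : Fin 3) (S.rPlus + 1)‖
      rw [PiLp.norm_single, Real.norm_eq_abs]
      exact (lt_add_one _).trans_le (le_abs_self _)
    refine le_ciInf fun x => ?_
    have h : 1 / (2 * rg) ≤ √(Riem.lambda1 T.metric (T.ball x rg)) := by
      refine Real.le_sqrt_of_sq_le (le_trans (le_of_eq ?_) (hlam x x.2))
      ring
    calc (1 / 2 : ℝ) = rg * (1 / (2 * rg)) := by field_simp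
      _ ≤ T.J rg x := mul_le_mul_of_nonneg_left h hrg.le
  · intro x hx hbar hbar0 e he ψ G hψ hnorm
    have h : hbar * (1 / (2 * rg)) ≤ Riem.sigmaP T.metric (T.ball x rg) hbar e ψ G :=
      Real.le_sqrt_of_sq_le
        (AdmissibleSlice.sq_le_momentumVar hrg (hopen x) (hsub x) hbar he hψ hnorm)
    calc hbar / 2 = hbar * (1 / (2 * rg)) * rg := by field_simp
      _ ≤ _ := mul_le_mul_of_nonneg_right h hrg.le
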